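/- Let $X$ be a separable (real or complex) Hilbert space and let $A:D(A)\subset X\to X$ be a densely defined linear operator such that (a) $A$ is self-adjoint; (b) $\langle Ax,x\rangle\ge-\sigma\|x\|^2$ for all $x\in D(A)$, for some $\sigma\ge0$; (c) there is $\lambda>-\sigma$ such that $(\lambda I+A)^{-1}:X\to X$ is compact. Let $B:X\to X$ be a bounded linear operator. Let $\lambda_j$ be an eigenvalue of $A$ and $\varphi_j$ a corresponding eigenvector with $\|\varphi_j\|=1$, and put $\psi_j(t)=e^{-\lambda_jt}\varphi_j$. Controls are scalar functions. All solutions are mild: the solution on $[0,T]$ of $u'+Au+g=0$, $u(0)=u_0$, is the function $u\in C([0,T];X)$ with $u(t)=e^{-tA}u_0-\int_0^te^{-(t-s)A}g(s)\,ds$. For $y_0\in X$ and $p\in L^2(0,T)$ let $y(\cdot;y_0,p)$ be the solution of $$y'(t)+Ay(t)+p(t)B\varphi_j=0,\qquad y(0)=y_0 .$$ The pair $\{A,B\}$ is $j$-null controllable in time $T$ if there is a constant $N_T>0$ such that for every $y_0\in X$ there is $p\in L^2(0,T)$ with $y(T;y_0,p)=0$ and $\|p\|_{L^2(0,T)}\le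 N_T\|y_0\|$. The control cost is $$N(T)=\sup_{\|y_0\|=1}\inf\{\|p\|_{L^2(0,T)}:\ y(T;y_0,p)=0\}.$$ Assume that $\{A,B\}$ is $j$-null controllable in every time $T>0$, and that there are constants $\nu,T_0>0$ with $$N(\tau)\le e^{\nu/\tau}\qquad\text{for all }0<\tau\le T_0 .$$ Write $\lambda_j^+=\max\{\lambda_j,0\}$ and define $$\sigma_j=\sigma+\lambda_j^+,\qquad \nu_j=\nu+\lambda_j^+\min\{1,T_0\}^2,$$ $$D=2\|B\|e^{2\sigma_j+3\|B\|/2+1/2}\max\{1,\|B\|\},\qquad \Gamma_0=2\nu_j+\max\{\ln D,0\}$$ (so that $\sigma_j=\sigma$ and $\nu_j=\nu$ if $\lambda_j\le0$), and for $T>0$ $$T_1=\min\Big\{\frac{6}{\pi^2}T,\,1,\,T_0\Big\},\qquad R_T=e^{-6\Gamma_0/T_1}>0 .$$ Then for every $T>0$ and every $u_0\in X$ with $\|u_0-\varphi_j\|<R_T$ there exists a control $p\in L^2(0,T)$ such that the solution $u$ of $$u'(t)+Au(t)+p(t)Bu(t)=0,\qquad u(0)=u_0,$$ satisfies $u(T)=\psi_j(T)$,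 and moreover $$\|p\|_{L^2(0,T)}^2\le\frac{e^{-\pi^2\Gamma_0/T}}{e^{2\pi^2\Gamma_0/(3T)}-1}.$$ -/

import Mathlib

open MeasureTheory Filter Topology Set
open scoped ENNReal InnerProductSpace

namespace BilinearControl

section

variable {𝕜 X : Type*} [RCLike 𝕜] [NormedAddCommGroup X] [InnerProductSpace 𝕜 X]

/-- `S` restricted to `[0, ∞)` is the strongly continuous semigroup `(e^{-tA})_{t ≥ 0}`, that is, the
`C₀`-semigroup of bounded operators whose infinitesimal generator (with its exact domain) is `-A`.
Only the values `S t` with `0 ≤ t` matter. -/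
structure IsSemigroupOf (A : X →ₗ.[𝕜] X) (S : ℝ → X →L[𝕜] X) : Prop where
  zero : S 0 = ContinuousLinearMap.id 𝕜 X
  add : ∀ s t : ℝ, 0 ≤ s → 0 ≤ t → S (s + t) = (S s).comp (S t)
  continuousOn : ∀ x : X, ContinuousOn (fun t : ℝ => S t x) (Ici 0)
  generator : ∀ x y : X,
    Tendsto (fun t : ℝ => ((t⁻¹ : ℝ) : 𝕜) • (S t x - x)) (𝓝[>] 0) (𝓝 y) ↔
      ∃ hx : x ∈ A.domain, A ⟨x, hx⟩ = -y

/-- `⟨A x, x⟩ ≥ -σ ‖x‖²` on the domain of `A`. -/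
def IsBoundedBelow (A : X →ₗ.[𝕜] X) (σ : ℝ) : Prop :=
  ∀ x : A.domain, -σ * ‖(x : X)‖ ^ 2 ≤ RCLike.re ⟪A x, (x : X)⟫_𝕜

/-- For some real `μ > -σ` the operator `μ I + A : D(A) → X` is bijective and its inverse
`R : X → X` is a compact operator. -/
def HasCompactResolvent (A : X →ₗ.[𝕜] X) (σ : ℝ) : Prop :=
  ∃ μ : ℝ, -σ < μ ∧ ∃ R : X →L[𝕜] X, IsCompactOperator R ∧
    (∀ x : X, ∃ hx : R x ∈ A.domain, (μ : 𝕜) • R x + A ⟨R x, hx⟩ = x) ∧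
    (∀ x : A.domain, R ((μ : 𝕜) • (x : X) + A x) = x)

/-- `p` is a scalar control in `L²(0,T)`. -/
def IsControl (T : ℝ) (p : ℝ → 𝕜) : Prop :=
  MemLp p 2 (volume.restrict (Ioo 0 T))

/-- The norm of a control in `L²(0,T)`, as an extended nonnegative real. -/
noncomputable def controlENorm (T : ℝ) (p : ℝ → 𝕜) : ℝ≥0∞ :=
  eLpNorm p 2 (volume.restrict (Ioo 0 T))

/-- The norm of a control in `L²(0,T)`, as a real number. -/
noncomputable def controlNorm (T : ℝ) (p : ℝ → 𝕜) : ℝ :=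
  (controlENorm T p).toReal

variable [NormedSpace ℝ X]

/-- `u` is a mild solution on `[0,T]` of `u'(t) + A u(t) + g(t) = 0`, `u(0) = u₀`:
`u ∈ C([0,T]; X)` and `u(t) = e^{-tA} u₀ - ∫₀ᵗ e^{-(t-s)A} g(s) ds` for all `t ∈ [0,T]`. -/
def IsMildSolution (A : X →ₗ.[𝕜] X) (T : ℝ) (g : ℝ → X) (u₀ : X) (u : ℝ → X) : Prop :=
  ContinuousOn u (Icc 0 T) ∧
    ∃ S : ℝ → X →L[𝕜] X, IsSemigroupOf A S ∧
      ∀ t ∈ Icc (0 : ℝ) T, u t = S t u₀ - ∫ s in (0 : ℝ)..t, S (t - s) (g s)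

/-- `u` is the mild solution on `[0,T]` of the bilinear problem
`u'(t) + A u(t) + p(t) B u(t) = 0`, `u(0) = u₀`. -/
def IsBilinearSolution (A : X →ₗ.[𝕜] X) (B : X →L[𝕜] X) (T : ℝ) (p : ℝ → 𝕜) (u₀ : X)
    (u : ℝ → X) : Prop :=
  IsMildSolution A T (fun s => p s • B (u s)) u₀ u

/-- `y` is the mild solution on `[0,T]` of the linear problem
`y'(t) + A y(t) + p(t) B φ = 0`, `y(0) = y₀`. -/
def IsLinearSolution (A : X →ₗ.[𝕜] X) (B : X →L[𝕜] X) (φ : X) (T : ℝ) (p : ℝ → 𝕜) (y₀ : X)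
    (y : ℝ → X) : Prop :=
  IsMildSolution A T (fun s => p s • B φ) y₀ y

/-- The control `p ∈ L²(0,T)` steers the linear problem from `y₀` to `0` in time `T`. -/
def SteersToZero (A : X →ₗ.[𝕜] X) (B : X →L[𝕜] X) (φ : X) (T : ℝ) (y₀ : X) (p : ℝ → 𝕜) : Prop :=
  IsControl T p ∧ ∃ y : ℝ → X, IsLinearSolution A B φ T p y₀ y ∧ y T = 0

/-- The pair `{A, B}` is `j`-null controllable in time `T`, where `φ = φ_j`. -/
def IsNullControllable (A : X →ₗ.[𝕜] X) (B : X →L[𝕜] X) (φ : X) (T : ℝ) : Prop :=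
  ∃ N : ℝ, 0 < N ∧ ∀ y₀ : X, ∃ p : ℝ → 𝕜, SteersToZero A B φ T y₀ p ∧ controlNorm T p ≤ N * ‖y₀‖

/-- The control cost `N(T) = sup_{‖y₀‖ = 1} inf {‖p‖_{L²(0,T)} : y(T; y₀, p) = 0}`, computed in
`[0, ∞]`. -/
noncomputable def controlCost (A : X →ₗ.[𝕜] X) (B : X →L[𝕜] X) (φ : X) (T : ℝ) : ℝ≥0∞ :=
  ⨆ (y₀ : X) (_ : ‖y₀‖ = 1), ⨅ (p : ℝ → 𝕜) (_ : SteersToZero A B φ T y₀ p), controlENorm T p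

end

/-- `D = 2 b e^{2σ + 3b/2 + 1/2} max {1, b}`, with `b = ‖B‖`. -/
noncomputable def constD (b σ : ℝ) : ℝ :=
  2 * b * Real.exp (2 * σ + 3 * b / 2 + 1 / 2) * max 1 b

/-- `Γ₀ = 2ν + max {ln D, 0}`. (For `b = 0` one has `ln D = -∞`, so that the maximum is `0`; this
agrees with the convention `Real.log 0 = 0`.) -/
noncomputable def constGamma (b σ ν : ℝ) : ℝ :=
  2 * ν + max (Real.log (constD b σ)) 0

/-- `T₁ = min {6T/π², 1, T₀}`. -/
noncomputable def constT1 (T T₀ : ℝ) : ℝ :=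
  min (6 / Real.pi ^ 2 * T) (min 1 T₀)

/-- `R_T = e^{-6Γ₀/T₁}`. -/
noncomputable def constR (Γ₀ T T₀ : ℝ) : ℝ :=
  Real.exp (-6 * Γ₀ / constT1 T T₀)

end BilinearControl

open BilinearControl

/-! Multiplying solutions by `e^{λ_j t}` turns `e^{-tA}` into a semigroup that fixes `φ_j`, and the
target trajectory `ψ_j` into the equilibrium `φ_j`. The rescaled semigroup grows at rate at most
`σ_j`, and its null-control cost is at most `c e^{ν_j/τ}` for any `c > 1` (`hasNullCost_rescale`).

The control comes from a Newton-type iteration. On a step of length `τ` starting at `φ + v`, apply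
to the bilinear system a control that steers the linearized system from `v` to `0`. The first-order
terms cancel at time `τ`, and the new error is at most `D e^{2ν_j/τ} ‖v‖²` (`IsMild.norm_sub_le`,
`le_constD_mul`).

The steps have lengths `T₁/k²`, with total `π²T₁/6 ≤ T`. Shrinking steps raise the cost to `e^{ν_j
k²/T₁}`, but squaring the error beats this: with `x = Γ₀/T₁` the errors stay below `exp(-x(n² + 4n +
6))`, whose value at `n = 0` is exactly `R_T` (`exists_control_step`). The squared norms of the
controls are dominated by a geometric series, so their concatenation is in `L²`. Continuity of the
solution gives the value `φ_j` at time `π²T₁/6`, and the zero control keeps it there until `T`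
(`exists_control_to_equilibrium`). -/

namespace BilinearControl

/-! ### Growth bound, uniqueness and eigenvectors of the semigroup generated by `-A` -/

section Generator

variable {𝕜 X : Type*} [RCLike 𝕜] [NormedAddCommGroup X] [InnerProductSpace 𝕜 X]

/-- Right differentiability of `f` with right derivative `-A (f t)` at every `t ≥ 0`. -/
def IsRightSolution (A : X →ₗ.[𝕜] X) (f : ℝ → X) : Prop :=
  ∀ t, 0 ≤ t → ∃ h : f t ∈ A.domain,
    Tendsto (fun s : ℝ => ((s⁻¹ : ℝ) : 𝕜) • (f (t + s) - f t)) (𝓝[>] 0) (𝓝 (-A ⟨f t, h⟩))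

theorem re_inner_sub_add (a b : X) :
    RCLike.re ⟪a - b, a + b⟫_𝕜 = ‖a‖ ^ 2 - ‖b‖ ^ 2 := by
  rw [inner_sub_left, inner_add_right, inner_add_right]
  simp only [map_sub, map_add, inner_self_eq_norm_sq]
  rw [inner_re_symm b a]
  ring

theorem tendsto_sub_const_nhdsGT (x : ℝ) : Tendsto (fun z : ℝ => z - x) (𝓝[>] x) (𝓝[>] 0) := by
  refine tendsto_nhdsWithin_iff.2 ⟨?_, ?_⟩
  · have : Tendsto (fun z : ℝ => z - x) (𝓝 x) (𝓝 (x - x)) := by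
      exact (continuous_id.sub continuous_const).tendsto x
    rw [sub_self] at this
    exact this.mono_left nhdsWithin_le_nhds
  · filter_upwards [self_mem_nhdsWithin] with z hz
    exact sub_pos.2 (mem_Ioi.1 hz)

/-- The right derivative of `‖f‖²` is `-2 Re ⟨Af, f⟩ ≤ 2σ‖f‖²`, so Gronwall's inequality applies; it
needs only one-sided derivatives, which is all that the generator provides. Applied to an orbit or
to a difference of two solutions, it yields the growth bound, uniqueness, and the action on
eigenvectors. -/
theorem IsRightSolution.norm_le {A : X →ₗ.[𝕜] X} {σ : ℝ} (hA : IsBoundedBelow A σ) {f : ℝ → X}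
    (hf : ContinuousOn f (Ici 0)) (hsol : IsRightSolution A f) {t : ℝ} (ht : 0 ≤ t) :
    ‖f t‖ ≤ Real.exp (σ * t) * ‖f 0‖ := by
  choose hdom hlim using hsol
  have hlim2 : ∀ x (hx : 0 ≤ x), Tendsto (fun z : ℝ => (z - x)⁻¹ * (‖f z‖ ^ 2 - ‖f x‖ ^ 2)) (𝓝[>] x)
      (𝓝 (RCLike.re ⟪-A ⟨f x, hdom x hx⟩, f x + f x⟫_𝕜)) := by
    intro x hx
    have h1 : Tendsto (fun z : ℝ => (((z - x)⁻¹ : ℝ) : 𝕜) • (f z - f x)) (𝓝[>] x)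
        (𝓝 (-A ⟨f x, hdom x hx⟩)) := by
      have := (hlim x hx).comp (tendsto_sub_const_nhdsGT x)
      refine this.congr fun z => ?_
      simp
    have h2 : Tendsto (fun z : ℝ => f z + f x) (𝓝[>] x) (𝓝 (f x + f x)) := by
      refine Tendsto.add ?_ tendsto_const_nhds
      exact (hf x hx).mono_left (nhdsWithin_mono _ fun y hy => le_trans hx (le_of_lt hy))
    refine ((RCLike.continuous_re.tendsto _).comp (h1.inner h2)).congr fun z => ?_
    simp only [Function.comp_apply, inner_smul_left, RCLike.conj_ofReal, RCLike.re_ofReal_mul,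
      re_inner_sub_add]
  have key := le_gronwallBound_of_liminf_deriv_right_le (f := fun t => ‖f t‖ ^ 2)
    (f' := fun x => if hx : 0 ≤ x then RCLike.re ⟪-A ⟨f x, hdom x hx⟩, f x + f x⟫_𝕜 else 0)
    (δ := ‖f 0‖ ^ 2) (K := 2 * σ) (ε := 0) (a := 0) (b := t)
    ((hf.norm.pow 2).mono fun x hx => hx.1)
    (by
      intro x hx r hr
      rw [dif_pos hx.1] at hr
      exact ((hlim2 x hx.1).eventually_lt_const hr).frequently)
    le_rfl
    (by
      intro x hx
      rw [dif_pos hx.1]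
      have := hA ⟨f x, hdom x hx.1⟩
      simp only [inner_neg_left, inner_add_right, map_neg, map_add] at this ⊢
      linarith)
    t ⟨ht, le_rfl⟩
  rw [gronwallBound_ε0, sub_zero] at key
  have h3 : ‖f t‖ ^ 2 ≤ (Real.exp (σ * t) * ‖f 0‖) ^ 2 := by
    rw [mul_pow, ← Real.exp_nat_mul]
    calc ‖f t‖ ^ 2 ≤ _ := key
      _ = _ := by rw [mul_comm]; push_cast; ring_nf
  exact (sq_le_sq₀ (norm_nonneg _) (by positivity)).1 h3

theorem IsRightSolution.sub {A : X →ₗ.[𝕜] X} {f g : ℝ → X} (hf : IsRightSolution A f)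
    (hg : IsRightSolution A g) : IsRightSolution A (fun t => f t - g t) := by
  intro t ht
  obtain ⟨h1, h1'⟩ := hf t ht
  obtain ⟨h2, h2'⟩ := hg t ht
  refine ⟨A.domain.sub_mem h1 h2, ?_⟩
  have h3 : -A ⟨f t - g t, A.domain.sub_mem h1 h2⟩ = -A ⟨f t, h1⟩ - -A ⟨g t, h2⟩ := by
    have : (⟨f t - g t, A.domain.sub_mem h1 h2⟩ : A.domain) = ⟨f t, h1⟩ - ⟨g t, h2⟩ := rfl
    rw [this, A.map_sub]
    abel
  rw [h3]
  refine (h1'.sub h2').congr fun s => ?_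
  rw [← smul_sub]
  congr 1
  exact (sub_sub_sub_comm _ _ _ _)

theorem IsSemigroupOf.isRightSolution {A : X →ₗ.[𝕜] X} {S : ℝ → X →L[𝕜] X}
    (hS : IsSemigroupOf A S) (x : A.domain) : IsRightSolution A (fun t => S t (x : X)) := by
  intro t ht
  have h0 : Tendsto (fun s : ℝ => ((s⁻¹ : ℝ) : 𝕜) • (S s (x : X) - x)) (𝓝[>] 0) (𝓝 (-A x)) :=
    (hS.generator x (-A x)).2 ⟨x.2, by simp⟩
  have h1 : Tendsto (fun s : ℝ => ((s⁻¹ : ℝ) : 𝕜) • (S (t + s) (x : X) - S t x)) (𝓝[>] 0)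
      (𝓝 (S t (-A x))) := by
    refine (((S t).continuous.tendsto _).comp h0).congr' ?_
    filter_upwards [self_mem_nhdsWithin] with s hs
    simp [hS.add t s ht (le_of_lt hs)]
  have h2 : Tendsto (fun s : ℝ => ((s⁻¹ : ℝ) : 𝕜) • (S s (S t (x : X)) - S t x)) (𝓝[>] 0)
      (𝓝 (S t (-A x))) := by
    refine h1.congr' ?_
    filter_upwards [self_mem_nhdsWithin] with s hs
    rw [add_comm t s, hS.add s t (le_of_lt hs) ht]
    rfl
  obtain ⟨h3, h4⟩ := (hS.generator _ _).1 h2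
  refine ⟨h3, ?_⟩
  rw [h4, neg_neg]
  exact h1

theorem IsSemigroupOf.norm_apply_le {A : X →ₗ.[𝕜] X} {S : ℝ → X →L[𝕜] X} {σ : ℝ}
    (hd : Dense (A.domain : Set X)) (hA : IsBoundedBelow A σ) (hS : IsSemigroupOf A S) {t : ℝ}
    (ht : 0 ≤ t) (x : X) : ‖S t x‖ ≤ Real.exp (σ * t) * ‖x‖ := by
  refine hd.induction (P := fun x => ‖S t x‖ ≤ Real.exp (σ * t) * ‖x‖) (fun y hy => ?_) ?_ x
  · have := (hS.isRightSolution ⟨y, hy⟩).norm_le hA (hS.continuousOn y) ht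
    simpa [hS.zero] using this
  · exact isClosed_le (by fun_prop) (by fun_prop)

/-- `IsMildSolution` quantifies the semigroup existentially, so different solutions may carry
different ones; this identifies them. -/
theorem IsSemigroupOf.unique {A : X →ₗ.[𝕜] X} {S S' : ℝ → X →L[𝕜] X} {σ : ℝ}
    (hd : Dense (A.domain : Set X)) (hA : IsBoundedBelow A σ) (hS : IsSemigroupOf A S)
    (hS' : IsSemigroupOf A S') {t : ℝ} (ht : 0 ≤ t) : S t = S' t := by
  ext x
  refine hd.induction (P := fun x => S t x = S' t x) (fun y hy => ?_) ?_ x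
  · have : ‖S t y - S' t y‖ ≤ Real.exp (σ * t) * ‖S 0 y - S' 0 y‖ :=
      ((hS.isRightSolution ⟨y, hy⟩).sub (hS'.isRightSolution ⟨y, hy⟩)).norm_le hA
      ((hS.continuousOn y).sub (hS'.continuousOn y)) ht
    simp only [hS.zero, hS'.zero, sub_self, norm_zero, mul_zero] at this
    exact sub_eq_zero.1 (norm_le_zero_iff.1 this)
  · exact isClosed_eq (by fun_prop) (by fun_prop)

theorem isRightSolution_eigenvector {A : X →ₗ.[𝕜] X} {lam : ℝ} {φ : A.domain}
    (hφ : A φ = (lam : 𝕜) • (φ : X)) :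
    IsRightSolution A (fun t => ((Real.exp (-lam * t) : ℝ) : 𝕜) • (φ : X)) := by
  intro t _
  refine ⟨A.domain.smul_mem _ φ.2, ?_⟩
  have h1 : A ⟨((Real.exp (-lam * t) : ℝ) : 𝕜) • (φ : X), A.domain.smul_mem _ φ.2⟩
      = ((Real.exp (-lam * t) : ℝ) : 𝕜) • (lam : 𝕜) • (φ : X) := by
    rw [← hφ, ← A.map_smul]
    rfl
  have h2 : HasDerivAt (fun s => Real.exp (-lam * s)) (Real.exp (-lam * t) * (-lam)) t := by
    simpa using ((hasDerivAt_id t).const_mul (-lam)).exp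
  have h3 := h2.tendsto_slope_zero_right
  have h4 : Tendsto (fun s : ℝ => ((s⁻¹ • (Real.exp (-lam * (t + s)) - Real.exp (-lam * t)) : ℝ) : 𝕜)
      • (φ : X)) (𝓝[>] 0) (𝓝 (((Real.exp (-lam * t) * (-lam) : ℝ) : 𝕜) • (φ : X))) :=
    ((RCLike.continuous_ofReal.tendsto _).comp h3).smul_const _
  rw [h1]
  convert h4 using 2
  · simp [sub_smul, smul_sub, mul_smul]
  · simp [mul_smul]

theorem IsSemigroupOf.apply_eigenvector {A : X →ₗ.[𝕜] X} {S : ℝ → X →L[𝕜] X} {σ lam : ℝ}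
    (hA : IsBoundedBelow A σ) (hS : IsSemigroupOf A S) {φ : A.domain}
    (hφ : A φ = (lam : 𝕜) • (φ : X)) {t : ℝ} (ht : 0 ≤ t) :
    S t φ = ((Real.exp (-lam * t) : ℝ) : 𝕜) • (φ : X) := by
  have : ‖S t φ - ((Real.exp (-lam * t) : ℝ) : 𝕜) • (φ : X)‖ ≤
      Real.exp (σ * t) * ‖S 0 φ - ((Real.exp (-lam * 0) : ℝ) : 𝕜) • (φ : X)‖ :=
    ((hS.isRightSolution φ).sub (isRightSolution_eigenvector hφ)).norm_le hA
      ((hS.continuousOn φ).sub (Continuous.continuousOn (by fun_prop))) ht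
  simp only [hS.zero, mul_zero, Real.exp_zero, RCLike.ofReal_one, one_smul,
    ContinuousLinearMap.id_apply, sub_self, norm_zero] at this
  exact sub_eq_zero.1 (norm_le_zero_iff.1 this)

end Generator

/-! ### Exponentially weighted integrals of a control -/

section Control

variable {𝕜 : Type*} [RCLike 𝕜]

theorem IsControl.integrableOn {T : ℝ} {p : ℝ → 𝕜} (hp : IsControl T p) :
    IntegrableOn p (Ioc 0 T) := by
  rw [integrableOn_Ioc_iff_integrableOn_Ioo]
  exact hp.integrable one_le_two

theorem IsControl.intervalIntegrable {T : ℝ} (hT : 0 ≤ T) {p : ℝ → 𝕜} (hp : IsControl T p) :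
    IntervalIntegrable p volume 0 T :=
  (intervalIntegrable_iff_integrableOn_Ioc_of_le hT).2 hp.integrableOn

theorem IsControl.intervalIntegrable_sq {T : ℝ} (hT : 0 ≤ T) {p : ℝ → 𝕜} (hp : IsControl T p) :
    IntervalIntegrable (fun s => ‖p s‖ ^ 2) volume 0 T := by
  rw [intervalIntegrable_iff_integrableOn_Ioc_of_le hT, integrableOn_Ioc_iff_integrableOn_Ioo]
  exact (memLp_two_iff_integrable_sq_norm hp.1).1 hp

/-- Young's inequality with weight `δ`, together with `∫ e^{-2k(t-s)} ds ≤ 1/(2k)`. Taking `δ` small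
and then `k` large makes the bound arbitrarily small. -/
theorem integral_norm_mul_exp_le {T k δ : ℝ} (hk : 0 < k) (hδ : 0 < δ) {p : ℝ → 𝕜}
    (hp : IsControl T p) {t : ℝ} (ht : t ∈ Icc 0 T) :
    ∫ s in (0 : ℝ)..t, ‖p s‖ * Real.exp (-k * (t - s)) ≤
      δ / 2 * (∫ s in (0 : ℝ)..T, ‖p s‖ ^ 2) + 1 / (4 * δ * k) := by
  have hT : 0 ≤ T := ht.1.trans ht.2
  have hsub : uIcc 0 t ⊆ uIcc 0 T := by
    rw [uIcc_of_le ht.1, uIcc_of_le hT]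
    exact Icc_subset_Icc_right ht.2
  have hp1 := (hp.intervalIntegrable hT).mono_set hsub
  have hp2 := (hp.intervalIntegrable_sq hT).mono_set hsub
  have hexp : ∫ s in (0 : ℝ)..t, Real.exp (-k * (t - s)) ^ 2 ≤ 1 / (2 * k) := by
    have h := intervalIntegral.integral_eq_sub_of_hasDerivAt (a := 0) (b := t)
      (f := fun s => Real.exp (-k * (t - s)) ^ 2 / (2 * k))
      (f' := fun s => Real.exp (-k * (t - s)) ^ 2) (fun s _ => by
        have h1 : HasDerivAt (fun s => Real.exp (-k * (t - s)))
            (Real.exp (-k * (t - s)) * (-k * (-1))) s :=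
          (((hasDerivAt_id s).const_sub t).const_mul (-k)).exp
        convert! (h1.pow 2).div_const (2 * k) using 1
        field_simp
        ring)
      (Continuous.intervalIntegrable (by fun_prop) _ _)
    rw [h, sub_self, mul_zero, Real.exp_zero, one_pow]
    have : 0 ≤ Real.exp (-k * (t - 0)) ^ 2 / (2 * k) := by positivity
    linarith
  have hmono : ∫ s in (0 : ℝ)..t, ‖p s‖ ^ 2 ≤ ∫ s in (0 : ℝ)..T, ‖p s‖ ^ 2 :=
    intervalIntegral.integral_mono_interval le_rfl ht.1 ht.2
      (Eventually.of_forall fun s => by positivity) (hp.intervalIntegrable_sq hT)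
  calc ∫ s in (0 : ℝ)..t, ‖p s‖ * Real.exp (-k * (t - s))
      ≤ ∫ s in (0 : ℝ)..t, (δ / 2 * ‖p s‖ ^ 2 + 1 / (2 * δ) * Real.exp (-k * (t - s)) ^ 2) := by
        refine intervalIntegral.integral_mono_on ht.1 ?_ ?_ fun s _ => ?_
        · exact hp1.norm.mul_continuousOn (Continuous.continuousOn (by fun_prop))
        · exact (hp2.const_mul _).add (Continuous.intervalIntegrable (by fun_prop) _ _)
        · have h := sq_nonneg (δ * ‖p s‖ - Real.exp (-k * (t - s)))
          have h' : δ / 2 * ‖p s‖ ^ 2 + 1 / (2 * δ) * Real.exp (-k * (t - s)) ^ 2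
              - ‖p s‖ * Real.exp (-k * (t - s))
              = (δ * ‖p s‖ - Real.exp (-k * (t - s))) ^ 2 / (2 * δ) := by
            field_simp
            ring
          have h'' : 0 ≤ (δ * ‖p s‖ - Real.exp (-k * (t - s))) ^ 2 / (2 * δ) := by positivity
          linarith
    _ = δ / 2 * (∫ s in (0 : ℝ)..t, ‖p s‖ ^ 2) +
          1 / (2 * δ) * ∫ s in (0 : ℝ)..t, Real.exp (-k * (t - s)) ^ 2 := by
        rw [intervalIntegral.integral_add (hp2.const_mul _)
          (Continuous.intervalIntegrable (by fun_prop) _ _),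
          intervalIntegral.integral_const_mul, intervalIntegral.integral_const_mul]
    _ ≤ δ / 2 * (∫ s in (0 : ℝ)..T, ‖p s‖ ^ 2) + 1 / (2 * δ) * (1 / (2 * k)) := by gcongr
    _ = _ := by
        congr 1
        field_simp
        norm_num

theorem exists_integral_norm_mul_exp_le {T : ℝ} {p : ℝ → 𝕜} (hp : IsControl T p) {c : ℝ}
    (hc : 0 < c) :
    ∃ k, 0 < k ∧ ∀ t ∈ Icc 0 T, ∫ s in (0 : ℝ)..t, ‖p s‖ * Real.exp (-k * (t - s)) ≤ c := by
  rcases lt_or_ge T 0 with hT | hT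
  · exact ⟨1, one_pos, fun t ht => absurd (ht.1.trans ht.2) (not_le.2 hT)⟩
  set J := ∫ s in (0 : ℝ)..T, ‖p s‖ ^ 2 with hJ
  have hJ0 : 0 ≤ J := intervalIntegral.integral_nonneg hT fun s _ => by positivity
  have hδ : 0 < c / (J + 1) := by positivity
  -- With `δ = c/(J+1)` the first term is at most `c/2`; this `k` makes the second equal to `c/2`.
  refine ⟨1 / (2 * (c / (J + 1)) * c), by positivity, fun t ht => ?_⟩
  refine (integral_norm_mul_exp_le (by positivity) hδ hp ht).trans ?_
  rw [← hJ]
  have h1 : c / (J + 1) / 2 * J ≤ c / 2 := by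
    rw [div_div, div_mul_eq_mul_div, div_le_div_iff₀ (by positivity) (by positivity)]
    nlinarith
  have h2 : 1 / (4 * (c / (J + 1)) * (1 / (2 * (c / (J + 1)) * c))) = c / 2 := by
    field_simp
    norm_num
  linarith

end Control

/-! ### Well-posedness of the bilinear equation with an `L²` control -/

section Semigroup

variable {𝕜 X : Type*} [RCLike 𝕜] [NormedAddCommGroup X] [NormedSpace 𝕜 X]

/-- `S` restricted to `[0, ∞)` is a `C₀`-semigroup with `‖S t‖ ≤ e^{ω t}`. -/
structure IsExpBounded (S : ℝ → X →L[𝕜] X) (ω : ℝ) : Prop where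
  zero : S 0 = ContinuousLinearMap.id 𝕜 X
  add : ∀ s t : ℝ, 0 ≤ s → 0 ≤ t → S (s + t) = (S s).comp (S t)
  continuousOn : ∀ x : X, ContinuousOn (fun t : ℝ => S t x) (Ici 0)
  norm_apply_le : ∀ t : ℝ, 0 ≤ t → ∀ x : X, ‖S t x‖ ≤ Real.exp (ω * t) * ‖x‖

/-- The rescaled semigroup `e^{μ t} S t`. -/
noncomputable def rescale (μ : ℝ) (S : ℝ → X →L[𝕜] X) (t : ℝ) : X →L[𝕜] X :=
  ((Real.exp (μ * t) : ℝ) : 𝕜) • S t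

theorem rescale_apply (μ : ℝ) (S : ℝ → X →L[𝕜] X) (t : ℝ) (x : X) :
    rescale μ S t x = ((Real.exp (μ * t) : ℝ) : 𝕜) • S t x := rfl

theorem rescale_neg_rescale (μ : ℝ) (S : ℝ → X →L[𝕜] X) : rescale (-μ) (rescale μ S) = S := by
  ext t x
  rw [rescale_apply, rescale_apply, smul_smul, ← RCLike.ofReal_mul, ← Real.exp_add]
  simp

theorem IsExpBounded.rescale {S : ℝ → X →L[𝕜] X} {ω : ℝ} (hS : IsExpBounded S ω) (μ : ℝ) :
    IsExpBounded (rescale μ S) (ω + μ) where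
  zero := by
    ext x
    simp [rescale_apply, hS.zero]
  add s t hs ht := by
    ext x
    simp only [rescale_apply, hS.add s t hs ht, ContinuousLinearMap.comp_apply, map_smul, smul_smul,
      mul_add, Real.exp_add, RCLike.ofReal_mul]
    rw [mul_comm]
  continuousOn x := by
    simp only [rescale_apply]
    exact (Continuous.continuousOn (by fun_prop)).smul (hS.continuousOn x)
  norm_apply_le t ht x := by
    rw [rescale_apply, norm_smul, RCLike.norm_ofReal, abs_of_pos (Real.exp_pos _), add_mul,
      Real.exp_add, mul_comm (Real.exp (ω * t)), mul_assoc]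
    gcongr
    exact hS.norm_apply_le t ht x

theorem IsExpBounded.continuousOn_uncurry {S : ℝ → X →L[𝕜] X} {ω : ℝ} (hS : IsExpBounded S ω)
    (T : ℝ) : ContinuousOn (fun q : ℝ × X => S q.1 q.2) (Icc 0 T ×ˢ univ) := by
  refine continuousOn_prod_of_continuousOn_lipschitzOnWith' _ (Real.exp (|ω| * T)).toNNReal
    (fun t ht => ?_) fun x _ => (hS.continuousOn x).mono fun t ht => ht.1
  refine (LipschitzWith.of_dist_le_mul fun x y => ?_).lipschitzOnWith
  rw [dist_eq_norm, dist_eq_norm, ← map_sub, Real.coe_toNNReal _ (Real.exp_pos _).le]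
  refine (hS.norm_apply_le t ht.1 _).trans ?_
  gcongr
  · exact ht.1
  · exact le_abs_self ω
  · exact ht.2

theorem IsExpBounded.continuousOn_convolution {S : ℝ → X →L[𝕜] X} {ω : ℝ} (hS : IsExpBounded S ω)
    {g : ℝ → X} {t : ℝ} (hg : ContinuousOn g (Icc 0 t)) :
    ContinuousOn (fun s => S (t - s) (g s)) (Icc 0 t) := by
  refine (hS.continuousOn_uncurry t).comp (f := fun s => (t - s, g s))
    ((Continuous.continuousOn (by fun_prop)).prodMk hg) fun s hs => ⟨?_, mem_univ _⟩
  exact ⟨sub_nonneg.2 hs.2, sub_le_self _ hs.1⟩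

theorem IsExpBounded.intervalIntegrable {S : ℝ → X →L[𝕜] X} {ω : ℝ} (hS : IsExpBounded S ω)
    {T : ℝ} {p : ℝ → 𝕜} (hp : IsControl T p) {g : ℝ → X} (hg : ContinuousOn g (Icc 0 T)) {t : ℝ}
    (ht : t ∈ Icc 0 T) : IntervalIntegrable (fun s => S (t - s) (p s • g s)) volume 0 t := by
  have hsub : uIcc 0 t ⊆ uIcc 0 T := by
    rw [uIcc_of_le ht.1, uIcc_of_le (ht.1.trans ht.2)]
    exact Icc_subset_Icc_right ht.2
  simp only [map_smul]
  refine ((hp.intervalIntegrable (ht.1.trans ht.2)).mono_set hsub).smul_continuousOn ?_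
  rw [uIcc_of_le ht.1]
  exact hS.continuousOn_convolution (hg.mono (Icc_subset_Icc_right ht.2))

/-- A decay rate `k`, depending on `p`, at which the Duhamel map contracts in the sup norm on all of
`[0,T]`. No subdivision of the interval is needed. -/
theorem exists_contraction_rate {T : ℝ} (B : X →L[𝕜] X) {p : ℝ → 𝕜} (hp : IsControl T p) :
    ∃ k, ∀ t ∈ Icc 0 T, ‖B‖ * ∫ s in (0 : ℝ)..t, ‖p s‖ * Real.exp (-k * (t - s)) ≤ 1 / 2 := by
  obtain ⟨k, -, hk⟩ := exists_integral_norm_mul_exp_le hp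
    (c := 1 / (2 * (‖B‖ + 1))) (by positivity)
  refine ⟨k, fun t ht => ?_⟩
  calc ‖B‖ * ∫ s in (0 : ℝ)..t, ‖p s‖ * Real.exp (-k * (t - s))
      ≤ ‖B‖ * (1 / (2 * (‖B‖ + 1))) := by
        gcongr
        exact hk t ht
    _ ≤ 1 / 2 := by
        rw [mul_one_div, div_le_div_iff₀ (by positivity) (by positivity)]
        linarith

variable [NormedSpace ℝ X]

/-- The Duhamel integral `∫₀ᵗ S (t - s) (p s • g s) ds`. -/
noncomputable def duhamel (S : ℝ → X →L[𝕜] X) (p : ℝ → 𝕜) (g : ℝ → X) (t : ℝ) : X :=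
  ∫ s in (0 : ℝ)..t, S (t - s) (p s • g s)

theorem IsExpBounded.norm_duhamel_le {S : ℝ → X →L[𝕜] X} {ω : ℝ} (hS : IsExpBounded S ω)
    {T : ℝ} {p : ℝ → 𝕜} (hp : IsControl T p) {g : ℝ → X} {t : ℝ}
    (ht : t ∈ Icc 0 T) {G : ℝ → ℝ} (hG : ContinuousOn G (Icc 0 T))
    (hgG : ∀ s ∈ Icc 0 T, ‖g s‖ ≤ G s) :
    ‖duhamel S p g t‖ ≤ ∫ s in (0 : ℝ)..t, ‖p s‖ * (Real.exp (ω * (t - s)) * G s) := by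
  have hsub : Icc 0 t ⊆ Icc 0 T := Icc_subset_Icc_right ht.2
  have hint := (hp.intervalIntegrable (ht.1.trans ht.2)).norm.mono_set
    (by rwa [uIcc_of_le ht.1, uIcc_of_le (ht.1.trans ht.2)] : uIcc 0 t ⊆ uIcc 0 T)
  refine intervalIntegral.norm_integral_le_of_norm_le ht.1
    (Eventually.of_forall fun s hs => ?_) (hint.mul_continuousOn ?_)
  · have hs' : s ∈ Icc 0 t := ⟨hs.1.le, hs.2⟩
    rw [map_smul, norm_smul]
    gcongr
    refine (hS.norm_apply_le _ (sub_nonneg.2 hs.2) _).trans ?_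
    gcongr
    exact hgG s (hsub hs')
  · rw [uIcc_of_le ht.1]
    exact (Continuous.continuousOn (by fun_prop)).mul (hG.mono hsub)

/-- Dominated convergence over the fixed interval `(0,T]`, the upper limit being moved into an
indicator. For each `s ≠ t₀` the integrand is continuous in `t` at `t₀`, and the dominating function
needs only `p ∈ L¹`. -/
theorem IsExpBounded.continuousOn_duhamel {S : ℝ → X →L[𝕜] X} {ω : ℝ} (hS : IsExpBounded S ω)
    {T : ℝ} {p : ℝ → 𝕜} (hp : IsControl T p) {g : ℝ → X} (hg : ContinuousOn g (Icc 0 T)) :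
    ContinuousOn (duhamel S p g) (Icc 0 T) := by
  obtain ⟨C, hC⟩ := isCompact_Icc.exists_bound_of_continuousOn hg
  have heq : ∀ t ∈ Icc 0 T, duhamel S p g t =
      ∫ s in Ioc 0 T, (Iic t).indicator (fun s => S (t - s) (p s • g s)) s := by
    intro t ht
    rw [setIntegral_indicator measurableSet_Iic, duhamel, intervalIntegral.integral_of_le ht.1,
      Ioc_inter_Iic, min_eq_right ht.2]
  refine ContinuousOn.congr (fun t₀ ht₀ => ?_) heq
  refine continuousWithinAt_of_dominated (bound := fun s => Real.exp (|ω| * T) * (‖p s‖ * C))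
    ?_ ?_ ?_ ?_
  · filter_upwards [self_mem_nhdsWithin] with t ht
    rw [aestronglyMeasurable_indicator_iff measurableSet_Iic,
      Measure.restrict_restrict measurableSet_Iic, inter_comm, Ioc_inter_Iic, min_eq_right ht.2]
    exact ((intervalIntegrable_iff_integrableOn_Ioc_of_le ht.1).1
      (hS.intervalIntegrable hp hg ht)).aestronglyMeasurable
  · filter_upwards [self_mem_nhdsWithin] with t ht
    refine (ae_restrict_iff' measurableSet_Ioc).2 (Eventually.of_forall fun s hs => ?_)
    have hCs := hC s ⟨hs.1.le, hs.2⟩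
    have hC0 : 0 ≤ C := (norm_nonneg _).trans hCs
    by_cases hst : s ≤ t
    · rw [indicator_of_mem (mem_Iic.2 hst)]
      refine (hS.norm_apply_le _ (sub_nonneg.2 hst) _).trans ?_
      rw [norm_smul]
      have h0 : 0 ≤ t - s := sub_nonneg.2 hst
      gcongr
      · exact le_abs_self ω
      · linarith [ht.2, hs.1]
    · rw [indicator_of_notMem (by simpa using hst), norm_zero]
      positivity
  · exact (hp.integrableOn.norm.mul_const C).const_mul _
  · refine (ae_restrict_iff' measurableSet_Ioc).2 ?_
    have hne : ∀ᵐ s : ℝ, s ≠ t₀ := by simp [ae_iff]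
    filter_upwards [hne] with s hs hsT
    rcases lt_or_gt_of_ne hs with hlt | hgt
    · have hev : (fun t => (Iic t).indicator (fun s => S (t - s) (p s • g s)) s)
          =ᶠ[𝓝[Icc 0 T] t₀] fun t => S (t - s) (p s • g s) := by
        filter_upwards [nhdsWithin_le_nhds (lt_mem_nhds hlt)] with t ht
        exact indicator_of_mem (mem_Iic.2 (le_of_lt ht)) _
      refine ContinuousWithinAt.congr_of_eventuallyEq ?_ hev (hev.self_of_nhdsWithin ht₀)
      have h1 : ContinuousAt (fun r => S r (p s • g s)) (t₀ - s) :=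
        (hS.continuousOn _).continuousAt (Ici_mem_nhds (sub_pos.2 hlt))
      have h2 : ContinuousAt (fun t => t - s) t₀ := by fun_prop
      exact (h1.comp (f := fun t => t - s) h2).continuousWithinAt
    · have hev : (fun t => (Iic t).indicator (fun s => S (t - s) (p s • g s)) s)
          =ᶠ[𝓝[Icc 0 T] t₀] fun _ => 0 := by
        filter_upwards [nhdsWithin_le_nhds (gt_mem_nhds hgt)] with t ht
        exact indicator_of_notMem (by simpa using ht) _
      exact continuousWithinAt_const.congr_of_eventuallyEq hev (hev.self_of_nhdsWithin ht₀)

theorem IsExpBounded.duhamel_sub {S : ℝ → X →L[𝕜] X} {ω : ℝ} (hS : IsExpBounded S ω)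
    {T : ℝ} {p : ℝ → 𝕜} (hp : IsControl T p) {g g' : ℝ → X} (hg : ContinuousOn g (Icc 0 T))
    (hg' : ContinuousOn g' (Icc 0 T)) {t : ℝ} (ht : t ∈ Icc 0 T) :
    duhamel S p (fun s => g s - g' s) t = duhamel S p g t - duhamel S p g' t := by
  simp only [duhamel]
  rw [← intervalIntegral.integral_sub (hS.intervalIntegrable hp hg ht)
    (hS.intervalIntegrable hp hg' ht)]
  simp only [smul_sub, map_sub]

theorem IsExpBounded.duhamel_add {S : ℝ → X →L[𝕜] X} {ω : ℝ} (hS : IsExpBounded S ω)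
    {T : ℝ} {p : ℝ → 𝕜} (hp : IsControl T p) {g g' : ℝ → X} (hg : ContinuousOn g (Icc 0 T))
    (hg' : ContinuousOn g' (Icc 0 T)) {t : ℝ} (ht : t ∈ Icc 0 T) :
    duhamel S p (fun s => g s + g' s) t = duhamel S p g t + duhamel S p g' t := by
  simp only [duhamel]
  rw [← intervalIntegral.integral_add (hS.intervalIntegrable hp hg ht)
    (hS.intervalIntegrable hp hg' ht)]
  simp only [smul_add, map_add]

/-- Mild solutions on `[0,T]` of the bilinear equation driven by the semigroup `S`. -/
def IsMild (S : ℝ → X →L[𝕜] X) (B : X →L[𝕜] X) (T : ℝ) (p : ℝ → 𝕜) (u₀ : X) (u : ℝ → X) : Prop :=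
  ContinuousOn u (Icc 0 T) ∧
    ∀ t ∈ Icc (0 : ℝ) T, u t = S t u₀ - duhamel S p (fun s => B (u s)) t

theorem duhamel_rescale [CompleteSpace X] (μ : ℝ) {S : ℝ → X →L[𝕜] X} {ω : ℝ}
    (hS : IsExpBounded S ω) {T : ℝ} {p : ℝ → 𝕜} (hp : IsControl T p) {g : ℝ → X}
    (hg : ContinuousOn g (Icc 0 T)) {t : ℝ} (ht : t ∈ Icc 0 T) :
    duhamel (rescale μ S) p (fun s => ((Real.exp (μ * s) : ℝ) : 𝕜) • g s) t =
      ((Real.exp (μ * t) : ℝ) : 𝕜) • duhamel S p g t := by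
  have h := ((((Real.exp (μ * t) : ℝ) : 𝕜) •
    ContinuousLinearMap.id 𝕜 X)).intervalIntegral_comp_comm (hS.intervalIntegrable hp hg ht)
  simp only [_root_.smul_apply, ContinuousLinearMap.id_apply] at h
  rw [duhamel, duhamel, ← h]
  refine intervalIntegral.integral_congr fun s _ => ?_
  simp only [rescale_apply, map_smul, smul_smul]
  congr 1
  have : Real.exp (μ * t) = Real.exp (μ * (t - s)) * Real.exp (μ * s) := by
    rw [← Real.exp_add]
    ring_nf
  rw [this, RCLike.ofReal_mul]
  ring

/-- The term `p B u` is linear in `u`, so the weight `e^{μt}` passes through it and the control is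
unchanged. -/
theorem IsMild.rescale [CompleteSpace X] (μ : ℝ) {S : ℝ → X →L[𝕜] X} {ω : ℝ}
    (hS : IsExpBounded S ω) {B : X →L[𝕜] X} {T : ℝ} {p : ℝ → 𝕜} (hp : IsControl T p) {u₀ : X}
    {u : ℝ → X} (hu : IsMild S B T p u₀ u) :
    IsMild (rescale μ S) B T p u₀ (fun t => ((Real.exp (μ * t) : ℝ) : 𝕜) • u t) := by
  refine ⟨(Continuous.continuousOn (by fun_prop)).smul hu.1, fun t ht => ?_⟩
  simp only [map_smul]
  have hB : ContinuousOn (fun s => B (u s)) (Icc 0 T) := B.continuous.comp_continuousOn hu.1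
  rw [duhamel_rescale μ hS hp hB ht, rescale_apply, ← smul_sub,
    ← hu.2 t ht]

/-- At a point where `‖u - u'‖` is maximal, the Duhamel formula bounds the maximum by `c < 1` times
itself. -/
theorem IsMild.eqOn_of_contraction {S : ℝ → X →L[𝕜] X} {k : ℝ} (hS : IsExpBounded S (-k))
    {B : X →L[𝕜] X} {T : ℝ} {p : ℝ → 𝕜} (hp : IsControl T p) {c : ℝ} (hc : c < 1)
    (hsmall : ∀ t ∈ Icc 0 T, ‖B‖ * ∫ s in (0 : ℝ)..t, ‖p s‖ * Real.exp (-k * (t - s)) ≤ c) {u₀ : X}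
    {u u' : ℝ → X} (hu : IsMild S B T p u₀ u) (hu' : IsMild S B T p u₀ u') :
    EqOn u u' (Icc 0 T) := by
  intro r hr
  obtain ⟨t, ht, hmax⟩ := isCompact_Icc.exists_isMaxOn ⟨r, hr⟩ (hu.1.sub hu'.1).norm
  have hB : ContinuousOn (fun s => B (u s)) (Icc 0 T) := B.continuous.comp_continuousOn hu.1
  have hB' : ContinuousOn (fun s => B (u' s)) (Icc 0 T) := B.continuous.comp_continuousOn hu'.1
  have h1 : u t - u' t = -duhamel S p (fun s => B (u s) - B (u' s)) t := by
    rw [hS.duhamel_sub hp hB hB' ht, hu.2 t ht, hu'.2 t ht]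
    abel
  have h2 : ‖u t - u' t‖ ≤ c * ‖u t - u' t‖ := by
    calc ‖u t - u' t‖ = ‖duhamel S p (fun s => B (u s) - B (u' s)) t‖ := by rw [h1, norm_neg]
      _ ≤ ∫ s in (0 : ℝ)..t, ‖p s‖ * (Real.exp (-k * (t - s)) * (‖B‖ * ‖u t - u' t‖)) := by
        refine hS.norm_duhamel_le hp ht continuousOn_const fun s hs => ?_
        rw [← map_sub]
        exact (B.le_opNorm _).trans (mul_le_mul_of_nonneg_left (hmax hs) (norm_nonneg _))
      _ = (‖B‖ * ∫ s in (0 : ℝ)..t, ‖p s‖ * Real.exp (-k * (t - s))) * ‖u t - u' t‖ := by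
        rw [← intervalIntegral.integral_const_mul, ← intervalIntegral.integral_mul_const]
        refine intervalIntegral.integral_congr fun s _ => ?_
        ring
      _ ≤ c * ‖u t - u' t‖ := by
        gcongr
        exact hsmall t ht
  have h3 : ‖u t - u' t‖ = 0 := by
    have := norm_nonneg (u t - u' t)
    nlinarith
  have h4 : ‖u r - u' r‖ ≤ 0 := h3 ▸ hmax hr
  exact sub_eq_zero.1 (norm_le_zero_iff.1 h4)

theorem exists_isMild_of_contraction [CompleteSpace X] {S : ℝ → X →L[𝕜] X} {k : ℝ}
    (hS : IsExpBounded S (-k)) {B : X →L[𝕜] X} {T : ℝ} (hT : 0 ≤ T) {p : ℝ → 𝕜}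
    (hp : IsControl T p)
    (hsmall : ∀ t ∈ Icc 0 T, ‖B‖ * ∫ s in (0 : ℝ)..t, ‖p s‖ * Real.exp (-k * (t - s)) ≤ 1 / 2)
    (u₀ : X) : ∃ u, IsMild S B T p u₀ u := by
  have hB : ∀ w : C(Icc 0 T, X), ContinuousOn (fun s => B (IccExtend hT w s)) (Icc 0 T) :=
    fun w => (B.continuous.comp (w.continuous.Icc_extend' (h := hT))).continuousOn
  have hcont : ∀ w : C(Icc 0 T, X),
      ContinuousOn (fun t => S t u₀ - duhamel S p (fun s => B (IccExtend hT w s)) t) (Icc 0 T) :=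
    fun w => ((hS.continuousOn u₀).mono fun t ht => ht.1).sub (hS.continuousOn_duhamel hp (hB w))
  let F : C(Icc 0 T, X) → C(Icc 0 T, X) := fun w =>
    ⟨(Icc 0 T).domRestrict (fun t => S t u₀ - duhamel S p (fun s => B (IccExtend hT w s)) t),
      (hcont w).domRestrict⟩
  have hF : ContractingWith (1 / 2) F := by
    refine ⟨by rw [← NNReal.coe_lt_coe]; norm_num, LipschitzWith.of_dist_le_mul fun w w' => ?_⟩
    rw [ContinuousMap.dist_le (by positivity)]
    rintro ⟨t, ht⟩
    have h1 : F w ⟨t, ht⟩ - F w' ⟨t, ht⟩ =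
        -duhamel S p (fun s => B (IccExtend hT w s) - B (IccExtend hT w' s)) t := by
      rw [hS.duhamel_sub hp (hB w) (hB w') ht]
      change (S t u₀ - _) - (S t u₀ - _) = _
      abel
    rw [dist_eq_norm, h1, norm_neg]
    calc ‖duhamel S p (fun s => B (IccExtend hT w s) - B (IccExtend hT w' s)) t‖
      _ ≤ ∫ s in (0 : ℝ)..t, ‖p s‖ * (Real.exp (-k * (t - s)) * (‖B‖ * dist w w')) := by
        refine hS.norm_duhamel_le hp ht continuousOn_const fun s hs => ?_
        rw [← map_sub, IccExtend_of_mem _ _ hs, IccExtend_of_mem _ _ hs]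
        refine (B.le_opNorm _).trans (mul_le_mul_of_nonneg_left ?_ (norm_nonneg _))
        rw [← dist_eq_norm]
        exact ContinuousMap.dist_apply_le_dist _
      _ = (‖B‖ * ∫ s in (0 : ℝ)..t, ‖p s‖ * Real.exp (-k * (t - s))) * dist w w' := by
        rw [← intervalIntegral.integral_const_mul, ← intervalIntegral.integral_mul_const]
        refine intervalIntegral.integral_congr fun s _ => ?_
        ring
      _ ≤ _ := by
        gcongr
        simpa using hsmall t ht
  obtain ⟨w, hw⟩ : ∃ w, F w = w := ⟨_, hF.fixedPoint_isFixedPt⟩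
  refine ⟨IccExtend hT w, w.continuous.Icc_extend'.continuousOn, fun t ht => ?_⟩
  rw [IccExtend_of_mem _ _ ht]
  exact (DFunLike.congr_fun hw ⟨t, ht⟩).symm

theorem IsExpBounded.exists_isMild [CompleteSpace X] {S : ℝ → X →L[𝕜] X} {ω : ℝ}
    (hS : IsExpBounded S ω) (B : X →L[𝕜] X) {T : ℝ} (hT : 0 ≤ T) {p : ℝ → 𝕜} (hp : IsControl T p)
    (u₀ : X) : ∃ u, IsMild S B T p u₀ u := by
  obtain ⟨k, hk⟩ := exists_contraction_rate B hp
  have hS' : IsExpBounded (BilinearControl.rescale (-(ω + k)) S) (-k) := by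
    convert hS.rescale (-(ω + k)) using 1
    ring
  obtain ⟨u, hu⟩ := exists_isMild_of_contraction hS' hT hp hk u₀
  have := hu.rescale (ω + k) hS' hp
  -- The first rewrite hits every occurrence of `ω + k`; the second restores the inner parameter
  -- `-(ω + k)`, so that the two rescalings cancel.
  rw [← neg_neg (ω + k), neg_neg (-(ω + k)), rescale_neg_rescale] at this
  exact ⟨_, this⟩

theorem IsMild.eqOn [CompleteSpace X] {S : ℝ → X →L[𝕜] X} {ω : ℝ}
    (hS : IsExpBounded S ω) {B : X →L[𝕜] X} {T : ℝ} {p : ℝ → 𝕜} (hp : IsControl T p)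
    {u₀ : X} {u u' : ℝ → X} (hu : IsMild S B T p u₀ u) (hu' : IsMild S B T p u₀ u') :
    EqOn u u' (Icc 0 T) := by
  obtain ⟨k, hk⟩ := exists_contraction_rate B hp
  have hS' : IsExpBounded (BilinearControl.rescale (-(ω + k)) S) (-k) := by
    convert hS.rescale (-(ω + k)) using 1
    ring
  intro t ht
  have h := (hu.rescale (-(ω + k)) hS hp).eqOn_of_contraction hS' hp (by norm_num) hk
    (hu'.rescale (-(ω + k)) hS hp) ht
  refine smul_right_injective X (r := ((Real.exp (-(ω + k) * t) : ℝ) : 𝕜)) ?_ h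
  exact RCLike.ofReal_ne_zero.2 (Real.exp_pos _).ne'

end Semigroup

/-! ### Comparison of the `L¹` and `L²` norms of a control -/

section Control

variable {𝕜 : Type*} [RCLike 𝕜]

theorem IsControl.integral_norm_le {T : ℝ} (hT : 0 ≤ T) (hT1 : T ≤ 1) {p : ℝ → 𝕜}
    (hp : IsControl T p) : ∫ s in (0 : ℝ)..T, ‖p s‖ ≤ controlNorm T p := by
  rw [intervalIntegral.integral_of_le hT, ← integral_Ioc_eq_integral_Ioo.symm,
    integral_norm_eq_lintegral_enorm hp.1, controlNorm, controlENorm]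
  refine ENNReal.toReal_mono hp.2.ne ?_
  rw [← eLpNorm_one_eq_lintegral_enorm]
  refine (eLpNorm_le_eLpNorm_mul_rpow_measure_univ (p := 1) (q := 2) one_le_two hp.1).trans ?_
  refine mul_le_of_le_one_right' (ENNReal.rpow_le_one ?_ (by norm_num))
  simpa using hT1

end Control

/-! ### Restarting solutions, and the quadratic error estimate -/

section Estimate

variable {𝕜 X : Type*} [RCLike 𝕜] [NormedAddCommGroup X] [NormedSpace 𝕜 X] [NormedSpace ℝ X]

/-- Agreement on a half-open interval is what concatenated controls offer; the endpoint is a null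
set. -/
theorem duhamel_congr_control {S : ℝ → X →L[𝕜] X} {p q : ℝ → 𝕜} {g : ℝ → X} {T t : ℝ}
    (hpq : ∀ s ∈ Ico 0 T, p s = q s) (ht : t ∈ Icc 0 T) :
    duhamel S p g t = duhamel S q g t := by
  refine intervalIntegral.integral_congr_ae ?_
  have hne : ∀ᵐ s : ℝ, s ≠ T := by simp [ae_iff]
  filter_upwards [hne] with s hs hst
  rw [uIoc_of_le ht.1] at hst
  rw [hpq s ⟨hst.1.le, lt_of_le_of_ne (hst.2.trans ht.2) hs⟩]

theorem IsMild.congr_control {S : ℝ → X →L[𝕜] X} {B : X →L[𝕜] X} {T : ℝ} {p q : ℝ → 𝕜} {u₀ : X}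
    {u : ℝ → X} (hu : IsMild S B T p u₀ u) (hpq : ∀ s ∈ Ico 0 T, p s = q s) :
    IsMild S B T q u₀ u :=
  ⟨hu.1, fun t ht => by rw [hu.2 t ht, duhamel_congr_control hpq ht]⟩

/-- Split the Duhamel integral at `a` and take `S t` out of the first part by the semigroup law. -/
theorem IsMild.shift [CompleteSpace X] {S : ℝ → X →L[𝕜] X} {ω : ℝ} (hS : IsExpBounded S ω)
    {B : X →L[𝕜] X} {T : ℝ} {p : ℝ → 𝕜} (hp : IsControl T p) {u₀ : X} {u : ℝ → X}
    (hu : IsMild S B T p u₀ u) {a τ : ℝ} (ha : 0 ≤ a) (haτ : a + τ ≤ T) :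
    IsMild S B τ (fun s => p (a + s)) (u a) (fun s => u (a + s)) := by
  have hB : ContinuousOn (fun s => B (u s)) (Icc 0 T) := B.continuous.comp_continuousOn hu.1
  refine ⟨hu.1.comp (f := fun s => a + s) (Continuous.continuousOn (by fun_prop)) fun s hs =>
    ⟨add_nonneg ha hs.1, by linarith [hs.2]⟩, fun t ht => ?_⟩
  have hat : a + t ∈ Icc 0 T := ⟨add_nonneg ha ht.1, by linarith [ht.2]⟩
  have haT : a ∈ Icc 0 T := ⟨ha, by linarith [ht.2, ht.1]⟩
  have hint := hS.intervalIntegrable hp hB hat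
  have h1 : IntervalIntegrable (fun s => S (a + t - s) (p s • B (u s))) volume 0 a := by
    refine hint.mono_set ?_
    rw [uIcc_of_le ha, uIcc_of_le hat.1]
    exact Icc_subset_Icc_right (by linarith [ht.1])
  have h2 : IntervalIntegrable (fun s => S (a + t - s) (p s • B (u s))) volume a (a + t) := by
    refine hint.mono_set ?_
    rw [uIcc_of_le (by linarith [ht.1]), uIcc_of_le hat.1]
    exact Icc_subset_Icc_left ha
  have h3 : duhamel S p (fun s => B (u s)) (a + t) = S t (duhamel S p (fun s => B (u s)) a) +
      duhamel S (fun s => p (a + s)) (fun s => B (u (a + s))) t := by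
    rw [duhamel, ← intervalIntegral.integral_add_adjacent_intervals h1 h2, duhamel,
      ← ContinuousLinearMap.intervalIntegral_comp_comm _ (hS.intervalIntegrable hp hB haT)]
    congr 1
    · refine intervalIntegral.integral_congr fun s hs => ?_
      rw [uIcc_of_le ha] at hs
      have : a + t - s = t + (a - s) := by ring
      simp only [this, hS.add t (a - s) ht.1 (sub_nonneg.2 hs.2), ContinuousLinearMap.comp_apply]
    · have := intervalIntegral.integral_comp_add_left (a := 0) (b := t)
        (fun s => S (a + t - s) (p s • B (u s))) a
      rw [add_zero] at this
      rw [← this, duhamel]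
      refine intervalIntegral.integral_congr fun s _ => ?_
      simp only [add_sub_add_left_eq_sub]
  beta_reduce
  rw [hu.2 _ hat, hu.2 a haT, h3, add_comm a t, hS.add t a ht.1 ha, map_sub]
  simp only [ContinuousLinearMap.comp_apply]
  abel

theorem IsExpBounded.norm_duhamel_le_mul {S : ℝ → X →L[𝕜] X} {ω : ℝ} (hS : IsExpBounded S ω)
    {T : ℝ} {p : ℝ → 𝕜} (hp : IsControl T p) {g : ℝ → X} {t : ℝ} (ht : t ∈ Icc 0 T) {C : ℝ}
    (hg : ∀ s ∈ Icc 0 T, ‖g s‖ ≤ Real.exp (ω * s) * C) :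
    ‖duhamel S p g t‖ ≤ Real.exp (ω * t) * (C * ∫ s in (0 : ℝ)..t, ‖p s‖) := by
  refine (hS.norm_duhamel_le hp ht (G := fun s => Real.exp (ω * s) * C)
    (Continuous.continuousOn (by fun_prop)) hg).trans (le_of_eq ?_)
  rw [← mul_assoc, ← intervalIntegral.integral_const_mul]
  refine intervalIntegral.integral_congr fun s _ => ?_
  have : Real.exp (ω * t) = Real.exp (ω * (t - s)) * Real.exp (ω * s) := by
    rw [← Real.exp_add]
    ring_nf
  simp only [this]
  ring

/-- A control that steers the linearized system to rest leaves the bilinear system at a distance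
from the equilibrium `φ` that is quadratic in the initial error. -/
theorem IsMild.norm_sub_le {S : ℝ → X →L[𝕜] X} {ω : ℝ} (hω : 0 ≤ ω) (hS : IsExpBounded S ω)
    {B : X →L[𝕜] X} {φ v : X} (hφ : ∀ t, 0 ≤ t → S t φ = φ) (hφ1 : ‖φ‖ = 1) {τ : ℝ} (hτ : 0 ≤ τ)
    (hτ1 : τ ≤ 1) {p : ℝ → 𝕜} (hp : IsControl τ p)
    (hsteer : S τ v = duhamel S p (fun _ => B φ) τ) {w : ℝ → X}
    (hw : IsMild S B τ p (φ + v) w) {I : ℝ} (hI : ∫ s in (0 : ℝ)..τ, ‖p s‖ ≤ I)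
    (hBI : ‖B‖ * I < 1) :
    ‖w τ - φ‖ * (1 - ‖B‖ * I) ≤ Real.exp ω * (‖B‖ * I * (‖v‖ + ‖B‖ * I)) := by
  have hτm : τ ∈ Icc 0 τ := ⟨hτ, le_rfl⟩
  have hI0 : 0 ≤ I := le_trans (intervalIntegral.integral_nonneg hτ fun _ _ => norm_nonneg _) hI
  have hd : ContinuousOn (fun s => w s - φ) (Icc 0 τ) := hw.1.sub continuousOn_const
  have hBd : ContinuousOn (fun s => B (w s - φ)) (Icc 0 τ) := B.continuous.comp_continuousOn hd
  have hIt : ∀ t ∈ Icc 0 τ, ∫ s in (0 : ℝ)..t, ‖p s‖ ≤ I := fun t ht =>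
    (intervalIntegral.integral_mono_interval le_rfl ht.1 ht.2
      (Eventually.of_forall fun s => norm_nonneg _) (hp.intervalIntegrable hτ).norm).trans hI
  have hdt : ∀ t ∈ Icc 0 τ, w t - φ = S t v - duhamel S p (fun s => B (w s)) t := by
    intro t ht
    rw [hw.2 t ht, map_add, hφ t ht.1]
    abel
  obtain ⟨r, hr, hmax⟩ := isCompact_Icc.exists_isMaxOn ⟨τ, hτm⟩
    (f := fun t => Real.exp (-(ω * t)) * ‖w t - φ‖)
    ((Continuous.continuousOn (by fun_prop)).mul hd.norm)
  -- The weight `e^{-ωt}` compensates the growth of the semigroup, so a closed inequality for the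
  -- single number `m` controls the error on the whole step.
  set m := Real.exp (-(ω * r)) * ‖w r - φ‖ with hm
  have hm0 : 0 ≤ m := by positivity
  have hdm : ∀ s ∈ Icc 0 τ, ‖w s - φ‖ ≤ Real.exp (ω * s) * m := by
    intro s hs
    have h : Real.exp (-(ω * s)) * ‖w s - φ‖ ≤ m := hmax hs
    rwa [Real.exp_neg, inv_mul_le_iff₀ (Real.exp_pos _)] at h
  have hm1 : m ≤ ‖v‖ + ‖B‖ * (m + 1) * I := by
    suffices h : ‖w r - φ‖ ≤ Real.exp (ω * r) * (‖v‖ + ‖B‖ * (m + 1) * I) by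
      refine hm.le.trans ?_
      rwa [Real.exp_neg, inv_mul_le_iff₀ (Real.exp_pos _)]
    rw [hdt r hr, mul_add]
    refine (_root_.norm_sub_le _ _).trans (add_le_add (hS.norm_apply_le r hr.1 v) ?_)
    refine (hS.norm_duhamel_le_mul hp hr (C := ‖B‖ * (m + 1)) fun s hs => ?_).trans ?_
    · refine (B.le_opNorm _).trans ?_
      have h1 : ‖w s‖ ≤ ‖w s - φ‖ + ‖φ‖ := by simpa using norm_add_le (w s - φ) φ
      have h2 : 1 ≤ Real.exp (ω * s) := Real.one_le_exp (mul_nonneg hω hs.1)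
      have h3 := hdm s hs
      calc ‖B‖ * ‖w s‖ ≤ ‖B‖ * (Real.exp (ω * s) * m + Real.exp (ω * s)) := by
            gcongr
            linarith
        _ = _ := by ring
    · exact mul_le_mul_of_nonneg_left (mul_le_mul_of_nonneg_left (hIt r hr) (by positivity))
        (Real.exp_pos _).le
  have hdτ : ‖w τ - φ‖ ≤ Real.exp ω * (‖B‖ * m * I) := by
    -- Write `B w = B (w - φ) + B φ`: by the choice of `p` the `B φ` part cancels `S τ v`. What
    -- remains is control times error, hence of second order.
    have h1 : w τ - φ = -duhamel S p (fun s => B (w s - φ)) τ := by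
      have h2 : (fun s => B (w s)) = fun s => B (w s - φ) + B φ := by
        ext s
        simp
      rw [hdt τ hτm, h2, hS.duhamel_add hp hBd continuousOn_const hτm, hsteer]
      abel
    rw [h1, norm_neg]
    refine (hS.norm_duhamel_le_mul hp hτm (C := ‖B‖ * m) fun s hs => ?_).trans ?_
    · calc ‖B (w s - φ)‖ ≤ ‖B‖ * ‖w s - φ‖ := B.le_opNorm _
        _ ≤ ‖B‖ * (Real.exp (ω * s) * m) := by
            gcongr
            exact hdm s hs
        _ = _ := by ring
    · have h3 : ω * τ ≤ ω := mul_le_of_le_one_right hω hτ1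
      calc Real.exp (ω * τ) * (‖B‖ * m * ∫ s in (0 : ℝ)..τ, ‖p s‖)
          ≤ Real.exp (ω * τ) * (‖B‖ * m * I) := by gcongr
        _ ≤ _ := by gcongr
  have h0 : 0 ≤ 1 - ‖B‖ * I := by linarith
  have hm2 : m * (1 - ‖B‖ * I) ≤ ‖v‖ + ‖B‖ * I := by linarith
  calc ‖w τ - φ‖ * (1 - ‖B‖ * I) ≤ Real.exp ω * (‖B‖ * m * I) * (1 - ‖B‖ * I) := by gcongr
    _ = Real.exp ω * (‖B‖ * I * (m * (1 - ‖B‖ * I))) := by ring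
    _ ≤ _ := by gcongr

end Estimate

/-! ### Numerical absorption into `D` and `Γ₀` -/

section Constants

theorem constD_nonneg {b : ℝ} (hb : 0 ≤ b) (σ : ℝ) : 0 ≤ constD b σ := by
  unfold constD
  positivity

theorem exp_half_gt : (1.648 : ℝ) < Real.exp (1 / 2) := by
  have h : Real.exp (1 / 2) ^ 2 = Real.exp 1 := by
    rw [← Real.exp_nat_mul]
    norm_num
  have := Real.exp_one_gt_d9
  by_contra! hc
  nlinarith [Real.exp_pos (1 / 2)]

/-- The constant `D` absorbs all the factors of the quadratic estimate. -/
theorem le_constD_mul {b ω y N c d : ℝ} (hb : 0 ≤ b) (hω : 0 ≤ ω) (hy : 0 ≤ y) (hN : 1 ≤ N)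
    (hc : 1 ≤ c) (hc' : c ≤ 1.05) (hNyD : N * y * constD b ω ≤ 1)
    (hd : b * (c * N * y) < 1 →
      d * (1 - b * (c * N * y)) ≤ Real.exp ω * (b * (c * N * y) * (y + b * (c * N * y)))) :
    b * (c * N * y) < 1 ∧ d ≤ constD b ω * N ^ 2 * y ^ 2 := by
  have hE := exp_half_gt
  set m := max 1 b with hm
  have hm1 : 1 ≤ m := le_max_left _ _
  have hmb : b ≤ m := le_max_right _ _
  have hD : 1.648 * (Real.exp ω * (2 * b * m)) ≤ constD b ω := by
    have h1 : 1.648 * Real.exp ω ≤ Real.exp (2 * ω + 3 * b / 2 + 1 / 2) := by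
      calc 1.648 * Real.exp ω ≤ Real.exp (1 / 2) * Real.exp ω := by gcongr
        _ = Real.exp (1 / 2 + ω) := (Real.exp_add _ _).symm
        _ ≤ _ := Real.exp_le_exp.2 (by linarith)
    have h2 : constD b ω = Real.exp (2 * ω + 3 * b / 2 + 1 / 2) * (2 * b * m) := by
      rw [constD, hm]
      ring
    rw [h2, ← mul_assoc]
    gcongr
  have hω1 : 1 ≤ Real.exp ω := Real.one_le_exp hω
  have hDb : 3.296 * b ≤ constD b ω := by
    refine le_trans ?_ hD
    have : b ≤ Real.exp ω * (b * m) := by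
      have h1 : 1 ≤ Real.exp ω * m := one_le_mul_of_one_le_of_one_le hω1 hm1
      nlinarith
    nlinarith
  have hNy0 : 0 ≤ N * y := by positivity
  have hbNy : 3.296 * (b * (N * y)) ≤ 1 := by nlinarith
  -- `1.05 / 3.296 < 0.319`, where `3.296 = 2 · 1.648`.
  have hz : b * (c * N * y) ≤ 0.319 := by
    have h0 : 0 ≤ b * (N * y) := by positivity
    have : b * (c * N * y) = c * (b * (N * y)) := by ring
    nlinarith
  have hz1 : b * (c * N * y) < 1 := by linarith
  refine ⟨hz1, ?_⟩
  have h1 := hd hz1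
  have hcN : 1 ≤ c * N := one_le_mul_of_one_le_of_one_le hc hN
  have h2 : y + b * (c * N * y) ≤ 2 * m * (c * N * y) := by
    have h3 : y ≤ c * N * y := le_mul_of_one_le_left hy hcN
    have h4 : 0 ≤ c * N * y := by positivity
    nlinarith
  -- `1.05² / 1.648 < 0.669`. Since `0.669 < 1 - 0.319`, dividing by `1 - b c N y` still leaves a
  -- factor below `1`.
  have h5 : Real.exp ω * (b * (c * N * y) * (y + b * (c * N * y))) ≤
      0.669 * (constD b ω * N ^ 2 * y ^ 2) := by
    calc Real.exp ω * (b * (c * N * y) * (y + b * (c * N * y)))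
        ≤ Real.exp ω * (b * (c * N * y) * (2 * m * (c * N * y))) := by gcongr
      _ = c ^ 2 * ((Real.exp ω * (2 * b * m)) * (N ^ 2 * y ^ 2)) := by ring
      _ ≤ 1.05 ^ 2 * ((Real.exp ω * (2 * b * m)) * (N ^ 2 * y ^ 2)) := by gcongr
      _ ≤ 0.669 * ((1.648 * (Real.exp ω * (2 * b * m))) * (N ^ 2 * y ^ 2)) := by
        have : 0 ≤ (Real.exp ω * (2 * b * m)) * (N ^ 2 * y ^ 2) := by positivity
        nlinarith
      _ ≤ 0.669 * (constD b ω * (N ^ 2 * y ^ 2)) := by gcongr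
      _ = _ := by ring
  have h6 : 0 ≤ constD b ω * N ^ 2 * y ^ 2 := by
    have := constD_nonneg hb ω
    positivity
  by_contra! hlt
  nlinarith

/-- This includes `D = 0`, where `Real.log 0 = 0` makes the right side `1`. -/
theorem constD_le_exp (b σ : ℝ) :
    constD b σ ≤ Real.exp (max (Real.log (constD b σ)) 0) :=
  (Real.le_exp_log _).trans (Real.exp_le_exp.2 (le_max_left _ _))

theorem constGamma_pos {b σ ν : ℝ} (hν : 0 < ν) : 0 < constGamma b σ ν := by
  have := le_max_right (Real.log (constD b σ)) 0
  unfold constGamma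
  linarith

end Constants

/-! ### Concatenation of countably many controls -/

section Concatenate

variable {𝕜 : Type*} [RCLike 𝕜]

/-- The control that follows `q n`, started afresh, on each interval `[t n, t (n + 1))`. -/
noncomputable def concatenate (t : ℕ → ℝ) (q : ℕ → ℝ → 𝕜) (s : ℝ) : 𝕜 :=
  ∑' n, (Ico (t n) (t (n + 1))).indicator (fun s => q n (s - t n)) s

theorem concatenate_eq {t : ℕ → ℝ} (ht : Monotone t) (q : ℕ → ℝ → 𝕜) {n : ℕ} {s : ℝ}
    (hs : s ∈ Ico (t n) (t (n + 1))) : concatenate t q s = q n (s - t n) := by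
  rw [concatenate, tsum_eq_single n, indicator_of_mem hs]
  intro m hm
  refine indicator_of_notMem (fun hm' => ?_) _
  exact disjoint_left.1 (ht.pairwise_disjoint_on_Ico_succ hm) hm' hs

theorem concatenate_eq_zero {t : ℕ → ℝ} (q : ℕ → ℝ → 𝕜) {s : ℝ}
    (hs : s ∉ ⋃ n, Ico (t n) (t (n + 1))) : concatenate t q s = 0 := by
  rw [concatenate, ← tsum_zero (α := 𝕜) (β := ℕ)]
  congr 1
  ext n
  exact indicator_of_notMem (fun h => hs (mem_iUnion.2 ⟨n, h⟩)) _

theorem aestronglyMeasurable_concatenate {t : ℕ → ℝ} (ht : Monotone t) {q : ℕ → ℝ → 𝕜}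
    (hq : ∀ n, IsControl (t (n + 1) - t n) (q n)) :
    AEStronglyMeasurable (concatenate t q) volume := by
  have hind : (⋃ n, Ico (t n) (t (n + 1))).indicator (concatenate t q) = concatenate t q := by
    ext s
    by_cases hs : s ∈ ⋃ n, Ico (t n) (t (n + 1))
    · rw [indicator_of_mem hs]
    · rw [indicator_of_notMem hs, concatenate_eq_zero q hs]
  rw [← hind, aestronglyMeasurable_indicator_iff (MeasurableSet.iUnion fun n => measurableSet_Ico),
    aestronglyMeasurable_iUnion_iff]
  intro n
  have h1 : AEStronglyMeasurable (fun s => q n (s - t n))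
      (volume.restrict (Ico (t n) (t (n + 1)))) := by
    have hmp : MeasurePreserving (fun s : ℝ => s - t n)
        (volume.restrict ((fun s : ℝ => s - t n) ⁻¹' Ico 0 (t (n + 1) - t n)))
        (volume.restrict (Ico 0 (t (n + 1) - t n))) :=
      (measurePreserving_sub_right volume (t n)).restrict_preimage measurableSet_Ico
    have hpre : (fun s : ℝ => s - t n) ⁻¹' Ico 0 (t (n + 1) - t n) = Ico (t n) (t (n + 1)) := by
      simp
    rw [hpre] at hmp
    have hqm : AEStronglyMeasurable (q n) (volume.restrict (Ico 0 (t (n + 1) - t n))) := by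
      rw [restrict_Ico_eq_restrict_Ioc, ← restrict_Ioo_eq_restrict_Ioc]
      exact (hq n).1
    exact hqm.comp_measurePreserving hmp
  refine h1.congr ((ae_restrict_iff' measurableSet_Ico).2 (Eventually.of_forall fun s hs => ?_))
  exact (concatenate_eq ht q hs).symm

theorem controlENorm_sq (T : ℝ) (p : ℝ → 𝕜) :
    controlENorm T p ^ 2 = ∫⁻ s in Ioo 0 T, ‖p s‖ₑ ^ 2 := by
  have := eLpNorm_nnreal_pow_eq_lintegral (f := p) (μ := volume.restrict (Ioo 0 T)) (p := 2)
    two_ne_zero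
  simpa [controlENorm] using this

theorem controlENorm_concatenate_sq_le {t : ℕ → ℝ} (ht : Monotone t) (q : ℕ → ℝ → 𝕜) (T : ℝ) :
    controlENorm T (concatenate t q) ^ 2 ≤ ∑' n, controlENorm (t (n + 1) - t n) (q n) ^ 2 := by
  rw [controlENorm_sq]
  calc ∫⁻ s in Ioo 0 T, ‖concatenate t q s‖ₑ ^ 2
      ≤ ∫⁻ s, ‖concatenate t q s‖ₑ ^ 2 := setLIntegral_le_lintegral _ _
    _ = ∫⁻ s in ⋃ n, Ico (t n) (t (n + 1)), ‖concatenate t q s‖ₑ ^ 2 := by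
        rw [← lintegral_indicator (MeasurableSet.iUnion fun n => measurableSet_Ico)]
        congr 1
        ext s
        by_cases hs : s ∈ ⋃ n, Ico (t n) (t (n + 1))
        · rw [indicator_of_mem hs]
        · rw [indicator_of_notMem hs, concatenate_eq_zero q hs]
          simp
    _ = ∑' n, ∫⁻ s in Ico (t n) (t (n + 1)), ‖concatenate t q s‖ₑ ^ 2 :=
        lintegral_iUnion (fun n => measurableSet_Ico) ht.pairwise_disjoint_on_Ico_succ _
    _ = ∑' n, controlENorm (t (n + 1) - t n) (q n) ^ 2 := by
        congr 1
        ext n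
        rw [controlENorm_sq, setLIntegral_congr_fun measurableSet_Ico
          (g := fun s => ‖q n (s - t n)‖ₑ ^ 2) fun s hs => by rw [concatenate_eq ht q hs]]
        rw [restrict_Ioo_eq_restrict_Ioc, ← restrict_Ico_eq_restrict_Ioc,
          ← lintegral_indicator measurableSet_Ico, ← lintegral_indicator measurableSet_Ico,
          ← lintegral_sub_right_eq_self
            ((Ico 0 (t (n + 1) - t n)).indicator fun s => ‖q n s‖ₑ ^ 2) (t n)]
        congr 1
        ext s
        simp only [indicator, mem_Ico, sub_nonneg, sub_lt_sub_iff_right]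

theorem isControl_concatenate {t : ℕ → ℝ} (ht : Monotone t) {q : ℕ → ℝ → 𝕜}
    (hq : ∀ n, IsControl (t (n + 1) - t n) (q n))
    (hsum : ∑' n, controlENorm (t (n + 1) - t n) (q n) ^ 2 ≠ ∞) (T : ℝ) :
    IsControl T (concatenate t q) := by
  refine ⟨(aestronglyMeasurable_concatenate ht hq).restrict, ?_⟩
  have h := (controlENorm_concatenate_sq_le ht q T).trans_lt hsum.lt_top
  rw [controlENorm] at h
  exact (ENNReal.pow_lt_top_iff).1 h |>.resolve_right two_ne_zero

end Concatenate

/-! ### One step of the iteration -/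

section Step

variable {𝕜 X : Type*} [RCLike 𝕜] [NormedAddCommGroup X] [NormedSpace 𝕜 X] [NormedSpace ℝ X]

/-- Null controllability of the linearized equation with cost at most `c e^{ν / τ}` in every time
`τ ≤ T₁`, expressed through the semigroup. -/
def HasNullCost (S : ℝ → X →L[𝕜] X) (B : X →L[𝕜] X) (φ : X) (T₁ ν c : ℝ) : Prop :=
  ∀ τ, 0 < τ → τ ≤ T₁ → ∀ y₀ : X, ∃ p : ℝ → 𝕜, IsControl τ p ∧
    S τ y₀ = duhamel S p (fun _ => B φ) τ ∧ controlNorm τ p ≤ c * Real.exp (ν / τ) * ‖y₀‖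

/-- The size of the error after `n` steps of the iteration. -/
noncomputable def errorBound (x : ℝ) (n : ℕ) : ℝ :=
  Real.exp (-(x * ((n : ℝ) ^ 2 + 4 * n + 6)))

/-- The size of the control used in step `n` of the iteration. -/
noncomputable def controlBound (x : ℝ) (n : ℕ) : ℝ :=
  Real.exp (-(x * ((n : ℝ) ^ 2 + 6 * n + 11) / 2))

/-- With `k = n + 1` and `x = Γ/T₁`, one has `D e^{2ν/τ} ≤ e^{x k²}`. The exponents are chosen so
that the recursion closes exactly: `2(n² + 4n + 6) - (n+1)² = n² + 6n + 11 = (n+1)² + 4(n+1) + 6`.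
The control exponent is half of this number, because `e^{ν/τ} ≤ e^{x k²/2}`. -/
theorem exists_control_step [CompleteSpace X] {S : ℝ → X →L[𝕜] X} {ω : ℝ} (hω : 0 ≤ ω)
    (hS : IsExpBounded S ω) {B : X →L[𝕜] X} {φ : X} (hφ : ∀ t, 0 ≤ t → S t φ = φ) (hφ1 : ‖φ‖ = 1)
    {T₁ ν c : ℝ} (hT₁ : 0 < T₁) (hT₁1 : T₁ ≤ 1) (hν : 0 < ν) (hc : 1 ≤ c) (hc' : c ≤ 1.05)
    (hcost : HasNullCost S B φ T₁ ν c) (n : ℕ) {v : X}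
    (hv : ‖v‖ ≤ errorBound (constGamma ‖B‖ ω ν / T₁) n) :
    ∃ (q : ℝ → 𝕜) (w : ℝ → X), IsControl (T₁ / ((n : ℝ) + 1) ^ 2) q ∧
      controlNorm (T₁ / ((n : ℝ) + 1) ^ 2) q ≤
        c * controlBound (constGamma ‖B‖ ω ν / T₁) n ∧
      IsMild S B (T₁ / ((n : ℝ) + 1) ^ 2) q (φ + v) w ∧
      ‖w (T₁ / ((n : ℝ) + 1) ^ 2) - φ‖ ≤ errorBound (constGamma ‖B‖ ω ν / T₁) (n + 1) := by
  set Γ := constGamma ‖B‖ ω ν with hΓ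
  set L := max (Real.log (constD ‖B‖ ω)) 0 with hL
  have hL0 : 0 ≤ L := le_max_right _ _
  have hΓL : Γ = 2 * ν + L := rfl
  have hD : constD ‖B‖ ω ≤ Real.exp L := constD_le_exp _ _
  set x := Γ / T₁ with hx
  set k : ℝ := (n : ℝ) + 1 with hk
  have hk1 : 1 ≤ k := by
    have : (0 : ℝ) ≤ n := Nat.cast_nonneg n
    linarith
  have hn : (n : ℝ) = k - 1 := by linarith
  have hk2 : 1 ≤ k ^ 2 := one_le_pow₀ hk1
  set τ := T₁ / k ^ 2 with hτ
  have hτ0 : 0 < τ := by positivity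
  have hτT : τ ≤ T₁ := div_le_self hT₁.le hk2
  set a := ν / T₁ with ha
  have ha0 : 0 < a := by positivity
  have hντ : ν / τ = a * k ^ 2 := by
    rw [hτ, ha]
    field_simp
  set l := L / T₁ with hl
  have hl0 : 0 ≤ l := by positivity
  have hLl : L ≤ l := by
    rw [hl, le_div_iff₀ hT₁]
    exact mul_le_of_le_one_right hL0 hT₁1
  have hxa : x = 2 * a + l := by
    rw [hx, hΓL, ha, hl]
    field_simp
  obtain ⟨q, hq, hsteer, hqn⟩ := hcost τ hτ0 hτT v
  obtain ⟨w, hw⟩ := hS.exists_isMild B hτ0.le hq (φ + v)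
  set N := Real.exp (ν / τ) with hN
  have hN1 : 1 ≤ N := Real.one_le_exp (by positivity)
  have hNv : N * ‖v‖ ≤ controlBound x n := by
    calc N * ‖v‖ ≤ N * errorBound x n := by gcongr
      _ = Real.exp (a * k ^ 2 + -(x * ((n : ℝ) ^ 2 + 4 * n + 6))) := by
        rw [errorBound, hN, hντ, Real.exp_add]
      _ ≤ controlBound x n := by
        rw [controlBound, Real.exp_le_exp, hn, hxa]
        nlinarith [mul_nonneg hl0 (sq_nonneg k)]
  have hNvD : N * ‖v‖ * constD ‖B‖ ω ≤ 1 := by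
    calc N * ‖v‖ * constD ‖B‖ ω ≤ controlBound x n * Real.exp L :=
          mul_le_mul hNv hD (constD_nonneg (norm_nonneg B) ω) (Real.exp_pos _).le
      _ = Real.exp (-(x * ((n : ℝ) ^ 2 + 6 * n + 11) / 2) + L) := by
          rw [controlBound, Real.exp_add]
      _ ≤ 1 := by
          rw [Real.exp_le_one_iff, hn, hxa]
          nlinarith [mul_nonneg hl0 (sub_nonneg.2 hk1), mul_nonneg ha0.le (sub_nonneg.2 hk1),
            mul_nonneg hl0 (sub_nonneg.2 hk2), mul_nonneg ha0.le (sub_nonneg.2 hk2)]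
  have hI : ∫ s in (0 : ℝ)..τ, ‖q s‖ ≤ c * N * ‖v‖ :=
    (hq.integral_norm_le hτ0.le (hτT.trans hT₁1)).trans hqn
  obtain ⟨-, hest⟩ := le_constD_mul (norm_nonneg B) hω (norm_nonneg v) hN1 hc hc' hNvD
    fun hz => hw.norm_sub_le hω hS hφ hφ1 hτ0.le (hτT.trans hT₁1) hq hsteer hI hz
  refine ⟨q, w, hq, hqn.trans ?_, hw, hest.trans ?_⟩
  · rw [mul_assoc]
    gcongr
  · calc constD ‖B‖ ω * N ^ 2 * ‖v‖ ^ 2 ≤ Real.exp L * N ^ 2 * errorBound x n ^ 2 := by gcongr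
      _ = Real.exp (L + 2 * (a * k ^ 2) + 2 * -(x * ((n : ℝ) ^ 2 + 4 * n + 6))) := by
        rw [errorBound, hN, hντ, Real.exp_add, Real.exp_add, ← Real.exp_nat_mul,
          ← Real.exp_nat_mul]
        norm_num
      -- Since `x k² = 2a k² + l k²`, this reduces to `L ≤ l k²`, which follows from `T₁ ≤ 1 ≤ k²`.
      _ ≤ errorBound x (n + 1) := by
        rw [errorBound, Real.exp_le_exp]
        push_cast
        rw [← hk, hn, hxa]
        nlinarith [mul_nonneg hl0 (sub_nonneg.2 hk2)]

end Step

/-! ### The infinite iteration and its limit -/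

section Iteration

/-- Discarding `n²` from the exponent leaves a geometric sequence. -/
theorem sq_controlBound_le {x : ℝ} (hx : 0 ≤ x) (n : ℕ) :
    controlBound x n ^ 2 ≤ Real.exp (-(11 * x)) * Real.exp (-(6 * x)) ^ n := by
  rw [controlBound, ← Real.exp_nat_mul, ← Real.exp_nat_mul, ← Real.exp_add, Real.exp_le_exp]
  have : 0 ≤ x * (n : ℝ) ^ 2 := by positivity
  push_cast
  linarith

theorem tendsto_errorBound {x : ℝ} (hx : 0 < x) : Tendsto (errorBound x) atTop (𝓝 0) := by
  refine Real.tendsto_exp_neg_atTop_nhds_zero.comp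
    (tendsto_atTop_mono (fun n => ?_) (tendsto_natCast_atTop_atTop.const_mul_atTop hx))
  have : 0 ≤ x * ((n : ℝ) ^ 2 + 3 * n + 6) := by positivity
  linarith

/-- The time reached after `n` steps of lengths `T₁ / k ^ 2`, `k = 1, …, n`. -/
noncomputable def stepTime (T₁ : ℝ) (n : ℕ) : ℝ :=
  ∑ k ∈ Finset.range n, T₁ / ((k : ℝ) + 1) ^ 2

theorem stepTime_succ (T₁ : ℝ) (n : ℕ) :
    stepTime T₁ (n + 1) = stepTime T₁ n + T₁ / ((n : ℝ) + 1) ^ 2 :=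
  Finset.sum_range_succ _ _

theorem monotone_stepTime {T₁ : ℝ} (hT₁ : 0 ≤ T₁) : Monotone (stepTime T₁) :=
  monotone_nat_of_le_succ fun n => by
    rw [stepTime_succ]
    exact le_add_of_nonneg_right (by positivity)

theorem tendsto_stepTime (T₁ : ℝ) :
    Tendsto (stepTime T₁) atTop (𝓝 (Real.pi ^ 2 / 6 * T₁)) := by
  -- The series `hasSum_zeta_two` starts at index `0` with the term `1/0² = 0`, which is removed
  -- here.
  have h := (hasSum_nat_add_iff' 1).2 hasSum_zeta_two
  simp only [Finset.range_one, Finset.sum_singleton, Nat.cast_zero, ne_eq, OfNat.ofNat_ne_zero,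
    not_false_eq_true, zero_pow, div_zero, sub_zero] at h
  refine (h.tendsto_sum_nat.mul_const T₁).congr fun n => ?_
  rw [stepTime, Finset.sum_mul]
  refine Finset.sum_congr rfl fun k _ => ?_
  push_cast
  ring

variable {𝕜 X : Type*} [RCLike 𝕜] [NormedAddCommGroup X] [NormedSpace 𝕜 X] [NormedSpace ℝ X]

theorem exists_control_to_equilibrium [CompleteSpace X] {S : ℝ → X →L[𝕜] X} {ω : ℝ} (hω : 0 ≤ ω)
    (hS : IsExpBounded S ω) {B : X →L[𝕜] X} {φ : X} (hφ : ∀ t, 0 ≤ t → S t φ = φ) (hφ1 : ‖φ‖ = 1)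
    {T₁ ν c : ℝ} (hT₁ : 0 < T₁) (hT₁1 : T₁ ≤ 1) (hν : 0 < ν) (hc : 1 ≤ c) (hc' : c ≤ 1.05)
    (hcost : HasNullCost S B φ T₁ ν c) {x : ℝ} (hx : x = constGamma ‖B‖ ω ν / T₁) {T : ℝ}
    (hT : Real.pi ^ 2 / 6 * T₁ ≤ T) {v₀ : X} (hv₀ : ‖v₀‖ ≤ errorBound x 0) :
    ∃ p : ℝ → 𝕜, IsControl T p ∧
      controlNorm T p ^ 2 ≤ c ^ 2 * (Real.exp (-(11 * x)) / (1 - Real.exp (-(6 * x)))) ∧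
      ∃ u, IsMild S B T p (φ + v₀) u ∧ u T = φ := by
  have hx0 : 0 < x := hx ▸ div_pos (constGamma_pos hν) hT₁
  have hstep := fun n v => exists_control_step hω hS hφ hφ1 hT₁ hT₁1 hν hc hc' hcost n (v := v)
  rw [← hx] at hstep
  -- `Q` and `W` are defined for every `v`, so the errors `V` can be set up by plain recursion
  -- before their bounds are known.
  choose! Q W hQ hQn hW hWn using hstep
  let V : ℕ → X := fun n => Nat.rec v₀ (fun n v => W n v (T₁ / ((n : ℝ) + 1) ^ 2) - φ) n
  have hVsucc : ∀ n, V (n + 1) = W n (V n) (T₁ / ((n : ℝ) + 1) ^ 2) - φ := fun n => rfl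
  have hV : ∀ n, ‖V n‖ ≤ errorBound x n := by
    intro n
    induction n with
    | zero => exact hv₀
    | succ n ih =>
      rw [hVsucc]
      exact hWn n _ ih
  have hmono := monotone_stepTime hT₁.le
  have hdiff : ∀ n, stepTime T₁ (n + 1) - stepTime T₁ n = T₁ / ((n : ℝ) + 1) ^ 2 := fun n => by
    rw [stepTime_succ, add_sub_cancel_left]
  set t := stepTime T₁ with ht
  set q : ℕ → ℝ → 𝕜 := fun n => Q n (V n) with hq
  set Tf := Real.pi ^ 2 / 6 * T₁ with hTf
  have hlim : Tendsto t atTop (𝓝 Tf) := tendsto_stepTime T₁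
  have ht0 : ∀ n, 0 ≤ t n := fun n => by
    rw [ht, stepTime]
    positivity
  have htTf : ∀ n, t n ≤ Tf := fun n => hmono.ge_of_tendsto hlim n
  have hTf0 : 0 ≤ Tf := by positivity
  have hqc : ∀ n, IsControl (t (n + 1) - t n) (q n) := fun n => by
    rw [hdiff]
    exact hQ n _ (hV n)
  have hr1 : Real.exp (-(6 * x)) < 1 := Real.exp_lt_one_iff.2 (by linarith)
  have hgeo := (hasSum_geometric_of_lt_one (Real.exp_pos _).le hr1).mul_left
    (c ^ 2 * Real.exp (-(11 * x)))
  have hbound : ∀ n, controlENorm (t (n + 1) - t n) (q n) ^ 2 ≤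
      ENNReal.ofReal (c ^ 2 * Real.exp (-(11 * x)) * Real.exp (-(6 * x)) ^ n) := by
    intro n
    have h1 : controlNorm (t (n + 1) - t n) (q n) ≤ c * controlBound x n := by
      rw [hdiff]
      exact hQn n _ (hV n)
    rw [← ENNReal.ofReal_toReal (a := controlENorm (t (n + 1) - t n) (q n)) (hqc n).2.ne,
      ← ENNReal.ofReal_pow ENNReal.toReal_nonneg]
    refine ENNReal.ofReal_le_ofReal ?_
    calc controlNorm (t (n + 1) - t n) (q n) ^ 2 ≤ (c * controlBound x n) ^ 2 :=
          pow_le_pow_left₀ ENNReal.toReal_nonneg h1 2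
      _ = c ^ 2 * controlBound x n ^ 2 := mul_pow _ _ _
      _ ≤ c ^ 2 * (Real.exp (-(11 * x)) * Real.exp (-(6 * x)) ^ n) := by
          gcongr
          exact sq_controlBound_le hx0.le n
      _ = _ := by ring
  have hsum : ∑' n, controlENorm (t (n + 1) - t n) (q n) ^ 2 ≤
      ENNReal.ofReal (c ^ 2 * (Real.exp (-(11 * x)) / (1 - Real.exp (-(6 * x))))) := by
    refine (ENNReal.tsum_le_tsum hbound).trans (le_of_eq ?_)
    rw [← ENNReal.ofReal_tsum_of_nonneg (fun n => by positivity) hgeo.summable, hgeo.tsum_eq,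
      mul_assoc, ← div_eq_mul_inv]
  have hp : IsControl T (concatenate t q) :=
    isControl_concatenate hmono hqc (ne_top_of_le_ne_top ENNReal.ofReal_ne_top hsum) T
  have hT0 : 0 ≤ T := hTf0.trans hT
  -- The solution for the concatenated control exists on all of `[0,T]` at once; uniqueness then
  -- matches it with `W` on each step, so no gluing is needed.
  obtain ⟨u, hu⟩ := hS.exists_isMild B hT0 hp (φ + v₀)
  have hut : ∀ n, u (t n) = φ + V n := by
    intro n
    induction n with
    | zero =>
      have h0 : t 0 = 0 := by simp [ht, stepTime]
      rw [h0, hu.2 0 ⟨le_rfl, hT0⟩, hS.zero, duhamel, intervalIntegral.integral_same, sub_zero]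
      rfl
    | succ n ih =>
      have hle : t n + T₁ / ((n : ℝ) + 1) ^ 2 ≤ T := by
        rw [← stepTime_succ]
        exact (htTf _).trans hT
      have h1 := hu.shift hS hp (ht0 n) hle
      rw [ih] at h1
      have h2 : IsMild S B (T₁ / ((n : ℝ) + 1) ^ 2) (Q n (V n)) (φ + V n) fun s => u (t n + s) := by
        refine h1.congr_control fun s hs => ?_
        rw [concatenate_eq hmono q (n := n) ⟨le_add_of_nonneg_right hs.1, ?_⟩, add_sub_cancel_left]
        rw [ht, stepTime_succ]
        exact (add_lt_add_iff_left _).2 hs.2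
      have h3 : u (t n + T₁ / ((n : ℝ) + 1) ^ 2) = W n (V n) (T₁ / ((n : ℝ) + 1) ^ 2) :=
        h2.eqOn hS (hQ n _ (hV n)) (hW n _ (hV n)) ⟨by positivity, le_rfl⟩
      rw [ht, stepTime_succ, h3, hVsucc]
      abel
  have huTf : u Tf = φ := by
    have h1 : Tendsto (fun n => u (t n)) atTop (𝓝 (u Tf)) :=
      (hu.1 Tf ⟨hTf0, hT⟩).tendsto.comp (tendsto_nhdsWithin_iff.2
        ⟨hlim, Eventually.of_forall fun n => ⟨ht0 n, (htTf n).trans hT⟩⟩)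
    have h2 : Tendsto V atTop (𝓝 0) := squeeze_zero_norm hV (tendsto_errorBound hx0)
    have h3 := h2.const_add φ
    rw [add_zero] at h3
    exact tendsto_nhds_unique h1 (h3.congr fun n => (hut n).symm)
  refine ⟨concatenate t q, hp, ?_, u, hu, ?_⟩
  · have h1 := (controlENorm_concatenate_sq_le hmono q T).trans hsum
    rw [controlNorm, ← ENNReal.toReal_pow]
    refine ENNReal.toReal_le_of_le_ofReal ?_ h1
    have := sub_pos.2 hr1
    positivity
  · have h1 := hu.shift hS hp hTf0 (τ := T - Tf) (by linarith)
    -- No step interval reaches past `Tf`, so the control vanishes there and `φ`, fixed by `S`,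
    -- persists.
    have h2 : ∀ s ∈ Ico 0 (T - Tf), concatenate t q (Tf + s) = (0 : ℝ → 𝕜) s := by
      intro s hs
      refine concatenate_eq_zero q fun hmem => ?_
      obtain ⟨n, hn⟩ := mem_iUnion.1 hmem
      exact absurd (hn.2.trans_le (htTf (n + 1))) (not_lt.2 (le_add_of_nonneg_right hs.1))
    have h3 := (h1.congr_control h2).2 (T - Tf) ⟨by linarith, le_rfl⟩
    simpa [huTf, hφ _ (sub_nonneg.2 hT), duhamel] using h3

end Iteration

/-! ### Transfer of the control cost to the rescaled semigroup -/

section Reduction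

variable {𝕜 X : Type*} [RCLike 𝕜] [NormedAddCommGroup X] [InnerProductSpace 𝕜 X]

theorem IsSemigroupOf.isExpBounded {A : X →ₗ.[𝕜] X} {S : ℝ → X →L[𝕜] X} {σ : ℝ}
    (hd : Dense (A.domain : Set X)) (hA : IsBoundedBelow A σ) (hS : IsSemigroupOf A S) :
    IsExpBounded S σ :=
  ⟨hS.zero, hS.add, hS.continuousOn, fun _ ht x => hS.norm_apply_le hd hA ht x⟩

theorem IsExpBounded.mono {S : ℝ → X →L[𝕜] X} {ω ω' : ℝ} (hS : IsExpBounded S ω) (h : ω ≤ ω') :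
    IsExpBounded S ω' :=
  ⟨hS.zero, hS.add, hS.continuousOn, fun t ht x => (hS.norm_apply_le t ht x).trans (by gcongr)⟩

variable [NormedSpace ℝ X]

theorem duhamel_congr_semigroup {S S' : ℝ → X →L[𝕜] X} (h : ∀ t, 0 ≤ t → S t = S' t)
    (p : ℝ → 𝕜) (g : ℝ → X) {t : ℝ} (ht : 0 ≤ t) : duhamel S p g t = duhamel S' p g t := by
  refine intervalIntegral.integral_congr fun s hs => ?_
  rw [uIcc_of_le ht] at hs
  simp only [h (t - s) (sub_nonneg.2 hs.2)]

theorem IsExpBounded.duhamel_smul [CompleteSpace X] {S : ℝ → X →L[𝕜] X} {ω : ℝ}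
    (hS : IsExpBounded S ω) {T : ℝ} {p : ℝ → 𝕜} (hp : IsControl T p) {g : ℝ → X}
    (hg : ContinuousOn g (Icc 0 T)) (a : 𝕜) {t : ℝ} (ht : t ∈ Icc 0 T) :
    duhamel S p (fun s => a • g s) t = a • duhamel S p g t := by
  have h := (a • ContinuousLinearMap.id 𝕜 X).intervalIntegral_comp_comm
    (hS.intervalIntegrable hp hg ht)
  simp only [_root_.smul_apply, ContinuousLinearMap.id_apply] at h
  rw [duhamel, duhamel, ← h]
  refine intervalIntegral.integral_congr fun s _ => ?_
  simp only [smul_comm (p s) a, map_smul]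

/-- Null controllability with cost `N(τ) ≤ e^{ν / τ}` passes to the semigroup rescaled by
`e^{μ t}`, at the price of any factor `c > 1` and of the change of `ν` into `ν + μ⁺ min {1, T₀}²`. -/
theorem hasNullCost_rescale [CompleteSpace X] {A : X →ₗ.[𝕜] X} {S : ℝ → X →L[𝕜] X} {σ : ℝ}
    (hd : Dense (A.domain : Set X)) (hA : IsBoundedBelow A σ) (hS : IsSemigroupOf A S)
    {B : X →L[𝕜] X} {φ : X} {ν T₀ : ℝ}
    (hcost : ∀ τ : ℝ, 0 < τ → τ ≤ T₀ →
      controlCost A B φ τ ≤ ENNReal.ofReal (Real.exp (ν / τ)))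
    (μ : ℝ) {T₁ : ℝ} (hT₁ : T₁ ≤ min 1 T₀) {c : ℝ} (hc : 1 < c) :
    HasNullCost (rescale μ S) B φ T₁ (ν + max μ 0 * min 1 T₀ ^ 2) c := by
  intro τ hτ hττ y₀
  have hSb := hS.isExpBounded hd hA
  rcases eq_or_ne y₀ 0 with rfl | hy
  · exact ⟨0, MemLp.zero, by simp [duhamel], by simp [controlNorm, controlENorm]⟩
  have hyn : 0 < ‖y₀‖ := norm_pos_iff.2 hy
  set y₁ : X := ((‖y₀‖⁻¹ : ℝ) : 𝕜) • y₀ with hy₁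
  have hy₁n : ‖y₁‖ = 1 := by
    rw [hy₁, norm_smul, RCLike.norm_ofReal, abs_of_pos (inv_pos.2 hyn), inv_mul_cancel₀ hyn.ne']
  have hy₀ : y₀ = ((‖y₀‖ : ℝ) : 𝕜) • y₁ := by
    rw [hy₁, smul_smul, ← RCLike.ofReal_mul, mul_inv_cancel₀ hyn.ne', RCLike.ofReal_one, one_smul]
  -- The infimum in the cost need not be attained; the factor `c > 1` gives the room to choose a
  -- control.
  have hlt : ⨅ (p : ℝ → 𝕜) (_ : SteersToZero A B φ τ y₁ p), controlENorm τ p <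
      ENNReal.ofReal (c * Real.exp (ν / τ)) := by
    refine lt_of_le_of_lt ?_ (lt_of_le_of_lt
      (hcost τ hτ (hττ.trans (hT₁.trans (min_le_right _ _)))) ?_)
    · exact le_iSup₂ (f := fun (y₀ : X) (_ : ‖y₀‖ = 1) =>
        ⨅ (p : ℝ → 𝕜) (_ : SteersToZero A B φ τ y₀ p), controlENorm τ p) y₁ hy₁n
    · rw [ENNReal.ofReal_lt_ofReal_iff (by positivity)]
      exact lt_mul_of_one_lt_left (Real.exp_pos _) hc
  simp only [iInf_lt_iff] at hlt
  obtain ⟨p, ⟨hp, y, ⟨-, S', hS', hy'⟩, hyτ⟩, hpn⟩ := hlt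
  have hτm : τ ∈ Icc 0 τ := ⟨hτ.le, le_rfl⟩
  have hSS' : ∀ t, 0 ≤ t → S' t = S t := fun t ht => hS'.unique hd hA hS ht
  have hsteer : S τ y₁ = duhamel S p (fun _ => B φ) τ := by
    have h := hy' τ hτm
    rw [hyτ, hSS' τ hτ.le] at h
    rw [← duhamel_congr_semigroup hSS' p _ hτ.le]
    exact sub_eq_zero.1 h.symm
  set K : ℝ := Real.exp (max μ 0 * τ) * ‖y₀‖ with hK
  have hK0 : 0 ≤ K := by positivity
  -- The factor `e^{μs}` accounts for the constant source `B φ`, which, unlike `B u`, does not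
  -- rescale with the solution; `‖y₀‖` undoes the normalization of the initial state.
  set q : ℝ → 𝕜 := fun s => p s * ((Real.exp (μ * s) : ℝ) : 𝕜) * ((‖y₀‖ : ℝ) : 𝕜) with hq
  have hle : ∀ᵐ s ∂(volume.restrict (Ioo 0 τ)), ‖q s‖ ≤ K * ‖p s‖ := by
    refine (ae_restrict_iff' measurableSet_Ioo).2 (Eventually.of_forall fun s hs => ?_)
    rw [hq, norm_mul, norm_mul, RCLike.norm_ofReal, RCLike.norm_ofReal,
      abs_of_pos (Real.exp_pos _), abs_of_pos hyn, mul_assoc, mul_comm, hK]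
    have h1 : μ * s ≤ max μ 0 * τ :=
      mul_le_mul (le_max_left _ _) hs.2.le hs.1.le (le_max_right _ _)
    gcongr
  have hqc : IsControl τ q := by
    refine hp.of_le_mul ?_ hle
    exact (hp.1.mul (Continuous.aestronglyMeasurable (by fun_prop))).mul
      aestronglyMeasurable_const
  refine ⟨q, hqc, ?_, ?_⟩
  · have h1 : duhamel (rescale μ S) q (fun _ => B φ) τ = duhamel (rescale μ S) p
        (fun s => ((Real.exp (μ * s) : ℝ) : 𝕜) • ((‖y₀‖ : ℝ) : 𝕜) • B φ) τ := by
      simp only [duhamel, hq, mul_smul]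
    rw [h1, duhamel_rescale μ hSb hp continuousOn_const hτm,
      hSb.duhamel_smul hp continuousOn_const _ hτm, ← hsteer, rescale_apply, ← map_smul (S τ) ((‖y₀‖ : ℝ) : 𝕜),
      ← hy₀]
  · have h2 : controlENorm τ q ≤ ENNReal.ofReal (K * (c * Real.exp (ν / τ))) := by
      rw [ENNReal.ofReal_mul hK0]
      refine (eLpNorm_le_mul_eLpNorm_of_ae_le_mul hle 2).trans ?_
      gcongr
      exact hpn.le
    refine (ENNReal.toReal_le_of_le_ofReal (by positivity) h2).trans ?_
    -- As `τ ≤ min 1 T₀`, the extra exponent satisfies `μ⁺ τ ≤ μ⁺ (min 1 T₀)² / τ`.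
    have h3 : max μ 0 * τ + ν / τ ≤ (ν + max μ 0 * min 1 T₀ ^ 2) / τ := by
      rw [le_div_iff₀ hτ, add_mul, div_mul_cancel₀ _ hτ.ne']
      have h4 : τ ^ 2 ≤ min 1 T₀ ^ 2 := pow_le_pow_left₀ hτ.le (hττ.trans hT₁) 2
      nlinarith [mul_le_mul_of_nonneg_left h4 (le_max_right μ 0)]
    calc K * (c * Real.exp (ν / τ)) = c * Real.exp (max μ 0 * τ + ν / τ) * ‖y₀‖ := by
          rw [hK, Real.exp_add]
          ring
      _ ≤ _ := by gcongr

/-- Split `11 = 1 + 6 + 4`: the factor `e^{-x}` absorbs `c²`, `e^{-6x}` gives the numerator, and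
`e^{-4x}` pays for the change of denominator. -/
theorem geometric_bound_le {c x y : ℝ} (hy : 0 < y) (hyx : y ≤ x) (hc : c ^ 2 ≤ Real.exp x) :
    c ^ 2 * (Real.exp (-(11 * x)) / (1 - Real.exp (-(6 * x)))) ≤
      Real.exp (-(6 * y)) / (Real.exp (4 * y) - 1) := by
  have hx : 0 < x := hy.trans_le hyx
  have h6 : 0 < 1 - Real.exp (-(6 * x)) := sub_pos.2 (Real.exp_lt_one_iff.2 (by linarith))
  have h4 : 0 < Real.exp (4 * y) - 1 := sub_pos.2 (Real.one_lt_exp_iff.2 (by linarith))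
  have h1 : Real.exp x * Real.exp (-(11 * x)) = Real.exp (-(6 * x)) * Real.exp (-(4 * x)) := by
    rw [← Real.exp_add, ← Real.exp_add]
    ring_nf
  have h2 : Real.exp (-(4 * x)) * (Real.exp (4 * y) - 1) ≤ 1 - Real.exp (-(6 * x)) := by
    have h3 : Real.exp (-(4 * x)) * Real.exp (4 * y) ≤ 1 := by
      rw [← Real.exp_add, Real.exp_le_one_iff]
      linarith
    have h5 : Real.exp (-(6 * x)) ≤ Real.exp (-(4 * x)) := Real.exp_le_exp.2 (by linarith)
    linarith
  rw [← mul_div_assoc, div_le_div_iff₀ h6 h4]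
  calc c ^ 2 * Real.exp (-(11 * x)) * (Real.exp (4 * y) - 1)
      ≤ Real.exp x * Real.exp (-(11 * x)) * (Real.exp (4 * y) - 1) := by gcongr
    _ = Real.exp (-(6 * x)) * (Real.exp (-(4 * x)) * (Real.exp (4 * y) - 1)) := by
        rw [h1, mul_assoc]
    _ ≤ Real.exp (-(6 * y)) * (1 - Real.exp (-(6 * x))) := by gcongr

end Reduction

end BilinearControl

/-! ### The main theorem -/

theorem theorem1p1 {𝕜 X : Type*} [RCLike 𝕜] [NormedAddCommGroup X] [InnerProductSpace 𝕜 X]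
    [NormedSpace ℝ X] [CompleteSpace X] [TopologicalSpace.SeparableSpace X]
    (A : X →ₗ.[𝕜] X) (B : X →L[𝕜] X) (σ : ℝ)
    (hA_dense : Dense (A.domain : Set X)) (hA_self : IsSelfAdjoint A)
    (hσ : 0 ≤ σ) (hA_below : IsBoundedBelow A σ) (hA_comp : HasCompactResolvent A σ)
    -- the `j`-th eigenvalue and a corresponding normalized eigenvector
    (lam_j : ℝ) (φ_j : A.domain) (hφ_norm : ‖(φ_j : X)‖ = 1)
    (hφ_eigen : A φ_j = (lam_j : 𝕜) • (φ_j : X))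
    (h_null : ∀ T : ℝ, 0 < T → IsNullControllable A B (φ_j : X) T)
    (ν T₀ : ℝ) (hν : 0 < ν) (hT₀ : 0 < T₀)
    (h_cost : ∀ τ : ℝ, 0 < τ → τ ≤ T₀ →
      controlCost A B (φ_j : X) τ ≤ ENNReal.ofReal (Real.exp (ν / τ)))
    (σ_j ν_j Γ₀ : ℝ) (hσ_j : σ_j = σ + max lam_j 0)
    (hν_j : ν_j = ν + max lam_j 0 * min 1 T₀ ^ 2)
    (hΓ₀ : Γ₀ = constGamma ‖B‖ σ_j ν_j) :
    ∀ T : ℝ, 0 < T → 0 < constR Γ₀ T T₀ ∧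
      ∀ u₀ ∈ Metric.ball (φ_j : X) (constR Γ₀ T T₀),
        ∃ p : ℝ → 𝕜, IsControl T p ∧
          (∃ u : ℝ → X, IsBilinearSolution A B T p u₀ u ∧
            u T = ((Real.exp (-lam_j * T) : ℝ) : 𝕜) • (φ_j : X)) ∧
          controlNorm T p ^ 2 ≤
            Real.exp (-(Real.pi ^ 2 * Γ₀ / T)) /
              (Real.exp (2 * Real.pi ^ 2 * Γ₀ / (3 * T)) - 1) := by
  intro T hT
  refine ⟨Real.exp_pos _, fun u₀ hu₀ => ?_⟩
  -- The semigroup is read off from a mild solution supplied by null controllability, so it need not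
  -- be constructed from `A`.
  obtain ⟨_, _, h0⟩ := h_null 1 one_pos
  obtain ⟨_, ⟨_, _, ⟨_, S, hS, _⟩, _⟩, _⟩ := h0 0
  have hmin : 0 < min 1 T₀ := lt_min one_pos hT₀
  have hlam : 0 ≤ max lam_j 0 := le_max_right _ _
  have hνj : 0 < ν_j := by
    rw [hν_j]
    positivity
  have hω : 0 ≤ σ_j := by
    rw [hσ_j]
    positivity
  have hΓ : 0 < Γ₀ := hΓ₀ ▸ constGamma_pos hνj
  have hT₁ : 0 < constT1 T T₀ := lt_min (by positivity) hmin
  have hT₁min : constT1 T T₀ ≤ min 1 T₀ := min_le_right _ _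
  have hT₁T : Real.pi ^ 2 / 6 * constT1 T T₀ ≤ T := by
    have h1 : constT1 T T₀ ≤ 6 / Real.pi ^ 2 * T := min_le_left _ _
    calc Real.pi ^ 2 / 6 * constT1 T T₀ ≤ Real.pi ^ 2 / 6 * (6 / Real.pi ^ 2 * T) := by gcongr
      _ = T := by field_simp
  set x := Γ₀ / constT1 T T₀ with hx
  have hx0 : 0 < x := by positivity
  have hSb := hS.isExpBounded hA_dense hA_below
  have hS' : IsExpBounded (rescale lam_j S) σ_j :=
    (hSb.rescale lam_j).mono (by rw [hσ_j]; gcongr; exact le_max_left _ _)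
  have hφ : ∀ t, 0 ≤ t → rescale lam_j S t (φ_j : X) = φ_j := by
    intro t ht
    rw [rescale_apply, hS.apply_eigenvector hA_below hφ_eigen ht, smul_smul, ← RCLike.ofReal_mul,
      ← Real.exp_add]
    simp
  -- The bound `1.05` is the tolerance of `le_constD_mul`, and `e^{x/2}` ensures `c² ≤ e^x` for
  -- `geometric_bound_le`.
  have hc : 1 < min 1.05 (Real.exp (x / 2)) :=
    lt_min (by norm_num) (Real.one_lt_exp_iff.2 (by positivity))
  have hcost := hasNullCost_rescale hA_dense hA_below hS h_cost lam_j hT₁min hc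
  rw [← hν_j] at hcost
  have hv₀ : ‖u₀ - φ_j‖ ≤ errorBound x 0 := by
    rw [mem_ball_iff_norm] at hu₀
    refine hu₀.le.trans (le_of_eq ?_)
    rw [constR, errorBound, hx]
    congr 1
    push_cast
    ring
  obtain ⟨p, hp, hpn, u, hu, huT⟩ := exists_control_to_equilibrium hω hS' hφ hφ_norm hT₁
    (hT₁min.trans (min_le_left _ _)) hνj hc.le (min_le_left _ _) hcost (x := x)
    (by rw [hx, hΓ₀]) hT₁T hv₀
  refine ⟨p, hp, ⟨fun t => ((Real.exp (-lam_j * t) : ℝ) : 𝕜) • u t, ?_, ?_⟩, hpn.trans ?_⟩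
  · have h1 := hu.rescale (-lam_j) hS' hp
    rw [rescale_neg_rescale, add_sub_cancel] at h1
    exact ⟨h1.1, S, hS, h1.2⟩
  · simp only [huT]
  -- With `y = π²Γ₀/(6T)`, the exponents `6y` and `4y` are those of the claimed bound; `y ≤ x`
  -- because `π²T₁/6 ≤ T`.
  · have hy0 : 0 < Real.pi ^ 2 / 6 * (Γ₀ / T) := by positivity
    have hyx : Real.pi ^ 2 / 6 * (Γ₀ / T) ≤ x := by
      rw [hx, ← mul_div_assoc, div_le_div_iff₀ hT hT₁]
      nlinarith [mul_le_mul_of_nonneg_left hT₁T hΓ.le]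
    have hcx : min 1.05 (Real.exp (x / 2)) ^ 2 ≤ Real.exp x := by
      calc min 1.05 (Real.exp (x / 2)) ^ 2 ≤ Real.exp (x / 2) ^ 2 :=
            pow_le_pow_left₀ (by positivity) (min_le_right _ _) 2
        _ = Real.exp x := by
            rw [← Real.exp_nat_mul]
            congr 1
            push_cast
            ring
    refine (geometric_bound_le hy0 hyx hcx).trans (le_of_eq ?_)
    congr 2
    · ring_nf
    · congr 1
      field_simp
      norm_num
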